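/- Let $K$ be a primitive quartic CM field, that is, a totally imaginary quadratic extension of a real quadratic field $K_0$ that contains no imaginary quadratic subfield. Let $\mathcal{O}_K$ be its ring of integers, $\Delta_0$ the discriminant of $K_0$, and $\Delta_1$ the norm of the relative discriminant of $K/K_0$. A principally polarized abelian surface over $\mathbf{C}$ is a pair $(\mathbf{C}^2/\Lambda,E)$, where $\Lambda$ is a lattice and $E$ is an alternating $\mathbf{R}$-bilinear form on $\mathbf{C}^2$ that is integral and of determinant $1$ on $\Lambda$, with $E(iu,iv)=E(u,v)$ for all $u,v$ and $E(iu,u)>0$ for all $u\neq 0$. It has CM by $\mathcal{O}_K$ if $\mathcal{O}_K$ embeds into the ring of $\mathbf{C}$-linear endomorphisms of $\mathbf{C}^2$ that map $\Lambda$ into itself. A $\mathbf{Z}$-basis $e_1,e_2,v_1,v_2$ of $\Lambda$ is symplectic if $E(e_i,v_j)=\delta_{ij}$ and $E(e_i,e_j)=E(v_i,v_j)=0$ for all $i,j$. Its period matrix is the symmetric matrix $Z=(Z_{ij})$ with positive definite imaginary part given by $e_j=\sum_i Z_{ij}v_i$. For a positive definite symmetric real $2\times 2$ matrix $Y$, let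 $m_1(Y)=p^{\mathrm t}Yp$ be the minimum of $x^{\mathrm t}Yx$ over all $x\in\mathbf{Z}^2\setminus\{0\}$, and let $m_2(Y)$ be the minimum of $q^{\mathrm t}Yq$ over all $q\in\mathbf{Z}^2$ linearly independent of $p$ (this does not depend on the choice of $p$). Every principally polarized abelian surface over $\mathbf{C}$ with CM by $\mathcal{O}_K$ has a symplectic basis for which the period matrix $Z'=X'+iY'$ satisfies $$\frac{\pi^2}{6\Delta_0}\leq\det Y'\leq\frac{\Delta_1^{1/2}}{4}$$ and $$\frac{2\pi}{\sqrt6\,\Delta_0^{3/2}}\leq m_1(Y')\leq m_2(Y')\leq\frac{\Delta_1^{1/4}\Delta_0^{1/2}}{3}.$$ If $\Delta_1\geq 16$, then such a $Z'$ moreover satisfies $m_2(Y')\leq\Delta_1^{1/2}\Delta_0^{1/2}/6$. Furthermore, for every symplectic basis of such a surface, the period matrix $Z$ satisfies $$m_2(\operatorname{Im} Z)\leq\max\left\{\frac{\sqrt6}{2\pi}\Delta_0^{3/2},\ \frac29\Delta_1^{1/2}\Delta_0^{1/2}\right\}.$$ -/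

import Mathlib

open NumberField

/-! ### Principally polarized abelian varieties as polarized complex tori -/

/-- The endomorphism ring of the complex torus `ℂ^g / Λ`: the ring of `ℂ`-linear endomorphisms
of `ℂ^g` that map `Λ` into itself. -/
def complexTorusEnd {g : ℕ} (Λ : Submodule ℤ (Fin g → ℂ)) :
    Subring (Module.End ℂ (Fin g → ℂ)) where
  carrier := {f | ∀ x ∈ Λ, f x ∈ Λ}
  mul_mem' hf hg x hx := hf _ (hg x hx)
  one_mem' _ hx := hx
  add_mem' hf hg x hx := Λ.add_mem (hf x hx) (hg x hx)
  zero_mem' _ _ := Λ.zero_mem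
  neg_mem' hf x hx := Λ.neg_mem (hf x hx)

/-- A principally polarized abelian variety over `ℂ` of dimension `g`: a pair `(ℂ^g / Λ, E)` with
`Λ` a full lattice in `ℂ^g` and `E` an alternating real bilinear form on `ℂ^g` that is integral
on `Λ`, satisfies `E(iu, iv) = E(u, v)`, makes `(u, v) ↦ E(iu, v)` positive definite, and has
determinant `1` on `Λ`. -/
structure PrincipallyPolarizedAbelianVariety (g : ℕ) where
  /-- the lattice `Λ` -/
  lattice : Submodule ℤ (Fin g → ℂ)
  /-- the polarization `E` -/
  form : LinearMap.BilinForm ℝ (Fin g → ℂ)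
  discrete : DiscreteTopology lattice
  isZLattice : IsZLattice ℝ lattice
  form_alt : ∀ u, form u u = 0
  form_integral : ∀ u ∈ lattice, ∀ v ∈ lattice, ∃ n : ℤ, form u v = n
  form_I : ∀ u v, form (Complex.I • u) (Complex.I • v) = form u v
  form_pos : ∀ u, u ≠ 0 → 0 < form (Complex.I • u) u
  form_principal : ∃ b : Module.Basis (Fin (2 * g)) ℤ lattice,
    (Matrix.of fun i j => form (b i) (b j)).det = 1

/-- An abelian variety of dimension `g` has complex multiplication by the ring of integers of a
number field `K` if `K` has degree `2g` and `𝓞 K` embeds into its endomorphism ring. -/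
def PrincipallyPolarizedAbelianVariety.HasCM {g : ℕ} (A : PrincipallyPolarizedAbelianVariety g)
    (K : Type*) [Field K] [NumberField K] : Prop :=
  Module.finrank ℚ K = 2 * g ∧
    ∃ φ : 𝓞 K →+* complexTorusEnd A.lattice, Function.Injective φ

/-! ### Symplectic bases and period matrices -/

/-- A basis `e₁, …, e_g, v₁, …, v_g` of the lattice is symplectic if the polarization is given with
respect to it by the matrix with blocks `0, 1, -1, 0`. The `e_i` are indexed by the left summand,
the `v_i` by the right one. -/
def PrincipallyPolarizedAbelianVariety.IsSymplecticBasis {g : ℕ}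
    (A : PrincipallyPolarizedAbelianVariety g)
    (b : Module.Basis (Fin g ⊕ Fin g) ℤ A.lattice) : Prop :=
  (Matrix.of fun i j => A.form (b i) (b j)) = Matrix.fromBlocks 0 1 (-1) 0

/-- `Z` is the period matrix of the basis `e₁, …, e_g, v₁, …, v_g`: its `j`-th column consists of
the coordinates of `e_j` with respect to `v₁, …, v_g`. -/
def PrincipallyPolarizedAbelianVariety.IsPeriodMatrix {g : ℕ}
    (A : PrincipallyPolarizedAbelianVariety g)
    (b : Module.Basis (Fin g ⊕ Fin g) ℤ A.lattice) (Z : Matrix (Fin g) (Fin g) ℂ) : Prop :=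
  ∀ j, (b (Sum.inl j) : Fin g → ℂ) = ∑ i, Z i j • (b (Sum.inr i) : Fin g → ℂ)

/-- The Siegel upper half space: symmetric complex `g × g` matrices with positive definite
imaginary part. -/
def siegelUpperHalfSpace (g : ℕ) : Set (Matrix (Fin g) (Fin g) ℂ) :=
  {Z | Z.IsSymm ∧ (Z.map Complex.im).PosDef}

/-! ### Consecutive minima of a binary quadratic form -/

/-- The value `pᵗ Y p` at an integral column vector `p`. -/
def intQuadForm (Y : Matrix (Fin 2) (Fin 2) ℝ) (p : Fin 2 → ℤ) : ℝ :=
  (fun i => (p i : ℝ)) ⬝ᵥ Y.mulVec (fun i => (p i : ℝ))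

/-- The first minimum `m₁(Y)` of a positive definite matrix `Y`: the minimum of `pᵗ Y p` over all
nonzero integral vectors `p`. -/
noncomputable def firstMinimum (Y : Matrix (Fin 2) (Fin 2) ℝ) : ℝ :=
  sInf {r | ∃ p : Fin 2 → ℤ, p ≠ 0 ∧ r = intQuadForm Y p}

/-- The second minimum `m₂(Y)` of a positive definite matrix `Y`: the minimum of `qᵗ Y q` over all
integral vectors `q` that are linearly independent of a vector `p` attaining `m₁(Y)`
(this minimum does not depend on the choice of `p`). -/
noncomputable def secondMinimum (Y : Matrix (Fin 2) (Fin 2) ℝ) : ℝ :=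
  sInf {r | ∃ p q : Fin 2 → ℤ, p ≠ 0 ∧ intQuadForm Y p = firstMinimum Y ∧
    LinearIndependent ℤ ![p, q] ∧ r = intQuadForm Y q}

/-! ### Quartic CM fields -/

/-- A quartic CM field is primitive if it contains no imaginary quadratic subfield. -/
def IsPrimitiveQuarticCMField (K : Type*) [Field K] [NumberField K] : Prop :=
  IsCMField K ∧ Module.finrank ℚ K = 4 ∧
    ∀ F : IntermediateField ℚ K, Module.finrank ℚ F = 2 → ¬ IsTotallyComplex F

/-- The discriminant `Δ₀` of the maximal real subfield of `K`. -/
noncomputable def realSubfieldDiscr (K : Type*) [Field K] [NumberField K] : ℤ :=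
  discr (maximalRealSubfield K)

/-- The relative discriminant ideal of `K` over its maximal real subfield `K₀`: the relative norm
of the relative different. -/
noncomputable def relDiscrIdeal (K : Type*) [Field K] [NumberField K] :
    Ideal (𝓞 (maximalRealSubfield K)) :=
  Ideal.relNorm (𝓞 (maximalRealSubfield K))
    (differentIdeal (𝓞 (maximalRealSubfield K)) (𝓞 K))

/-- The norm `Δ₁` of the relative discriminant of `K` over its maximal real subfield. -/
noncomputable def relDiscrNorm (K : Type*) [Field K] [NumberField K] : ℕ :=
  Ideal.absNorm (relDiscrIdeal K)

/-! ### Binary quadratic forms -/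

/-! Complex multiplication reduces every bound to the size of products `|x₀x₁|` of two coordinates.
A purely imaginary integer `T` of `K` whose square generates `K₀` acts on `ℂ²` so that `T²` has two
distinct eigenvalues. Primitivity of `K` makes the two eigenlines orthogonal for `E`. After scaling,
`𝓞 K` acts through two embeddings and `E(x, y) = ∑ Im(x_k ȳ_k)` (`nonempty_cmCoordinates`), so
`E(ix, x) = |x₀|² + |x₁|² ≥ 2|x₀x₁|`.

For `Y = Im Z`, the inverse `Y⁻¹` is the Gram matrix of `E(iu, v)` on the `v_i`; hence `Y[p] = det Y
· E(ix, x)` for a lattice vector `x` attached to `p` (`intQuadForm_im`). If `M·w ⊆ Λ` for an ideal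
`M` of `𝓞 K`, integrality of the index bounds `|w₀w₁|` below (`one_le_covolume`). With `M = 𝓞 K`
this bounds `m₁(Y) / det Y` below, and `m₁m₂ ≤ (4/3) det Y` then gives `m₂ ≤ Δ₁^{1/4} Δ₀^{1/2} / 3`
for every symplectic basis (`secondMinimum_im_le`). Both other upper bounds for `m₂` follow from
this one.

For the special basis, Minkowski's theorem supplies a nonzero `v ∈ Λ` with `|v₀v₁|² ≤ 6/π²`. The
saturation of `𝓞 K₀ · v` is `I·w` for an ideal `I` of `𝓞 K₀`
(`exists_realMultiplication_sublattice`). It is isotropic, so it is spanned by half of a symplectic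
basis. With `M = N(I)|w₀w₁|` one gets `det Y = 1/(Δ₀M²)` and `m₁ ≥ 2M det Y`. Here `M ≤ |v₀v₁|`
since `v ∈ I·w`, and `Δ₀²Δ₁M⁴ ≥ 16` by the covolume bound for `I·𝓞 K`. -/

theorem intQuadForm_eq {Y : Matrix (Fin 2) (Fin 2) ℝ} (hs : Y 1 0 = Y 0 1) (p : Fin 2 → ℤ) :
    intQuadForm Y p = Y 0 0 * p 0 ^ 2 + 2 * Y 0 1 * p 0 * p 1 + Y 1 1 * p 1 ^ 2 := by
  simp only [intQuadForm, dotProduct, Matrix.mulVec, Fin.sum_univ_two, hs]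
  ring

theorem intQuadForm_mul_fst {Y : Matrix (Fin 2) (Fin 2) ℝ} (hs : Y 1 0 = Y 0 1) (p : Fin 2 → ℤ) :
    Y 0 0 * intQuadForm Y p = (Y 0 0 * p 0 + Y 0 1 * p 1) ^ 2 + Y.det * p 1 ^ 2 := by
  rw [intQuadForm_eq hs, Matrix.det_fin_two, hs]; ring

theorem intQuadForm_mul_snd {Y : Matrix (Fin 2) (Fin 2) ℝ} (hs : Y 1 0 = Y 0 1) (p : Fin 2 → ℤ) :
    Y 1 1 * intQuadForm Y p = (Y 0 1 * p 0 + Y 1 1 * p 1) ^ 2 + Y.det * p 0 ^ 2 := by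
  rw [intQuadForm_eq hs, Matrix.det_fin_two, hs]; ring

theorem snd_diag_pos {Y : Matrix (Fin 2) (Fin 2) ℝ} (hs : Y 1 0 = Y 0 1) (ha : 0 < Y 0 0)
    (hd : 0 < Y.det) : 0 < Y 1 1 := by
  rw [Matrix.det_fin_two, hs] at hd
  nlinarith [sq_nonneg (Y 0 1)]

theorem fin_two_ne_zero {p : Fin 2 → ℤ} (hp : p ≠ 0) : p 0 ≠ 0 ∨ p 1 ≠ 0 := by
  by_contra! h
  exact hp (funext fun i => by fin_cases i <;> simp [h.1, h.2])

theorem intQuadForm_pos {Y : Matrix (Fin 2) (Fin 2) ℝ} (hs : Y 1 0 = Y 0 1) (ha : 0 < Y 0 0)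
    (hd : 0 < Y.det) {p : Fin 2 → ℤ} (hp : p ≠ 0) : 0 < intQuadForm Y p := by
  rcases fin_two_ne_zero hp with h | h
  · have h1 := intQuadForm_mul_snd hs p
    have h2 : 0 < Y.det * (p 0 : ℝ) ^ 2 := by positivity
    have : 0 < Y 1 1 * intQuadForm Y p := by rw [h1]; positivity
    exact pos_of_mul_pos_right this (snd_diag_pos hs ha hd).le
  · have h1 := intQuadForm_mul_fst hs p
    have h2 : 0 < Y.det * (p 1 : ℝ) ^ 2 := by positivity
    have : 0 < Y 0 0 * intQuadForm Y p := by rw [h1]; positivity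
    exact pos_of_mul_pos_right this ha.le

theorem int_sq_le_mem_Icc {n : ℤ} {C : ℝ} (h : (n : ℝ) ^ 2 ≤ C) : n ∈ Set.Icc (-⌈C⌉) ⌈C⌉ := by
  have h1 : (n : ℝ) ^ 2 ≤ (⌈C⌉ : ℝ) := h.trans (Int.le_ceil C)
  have h2 : n ^ 2 ≤ ⌈C⌉ := by exact_mod_cast h1
  have h3 := Int.le_self_sq n
  have h4 := Int.le_self_sq (-n)
  rw [neg_sq] at h4
  constructor <;> omega

theorem finite_setOf_intQuadForm_le {Y : Matrix (Fin 2) (Fin 2) ℝ} (hs : Y 1 0 = Y 0 1)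
    (ha : 0 < Y 0 0) (hd : 0 < Y.det) (C : ℝ) : {p | intQuadForm Y p ≤ C}.Finite := by
  have hc := snd_diag_pos hs ha hd
  refine Set.Finite.subset (Set.Finite.pi' (t := ![Set.Icc (-⌈Y 1 1 * C / Y.det⌉) ⌈Y 1 1 * C / Y.det⌉,
    Set.Icc (-⌈Y 0 0 * C / Y.det⌉) ⌈Y 0 0 * C / Y.det⌉]) ?_) ?_
  · intro i; fin_cases i <;> exact Set.finite_Icc _ _
  · intro p (hp : intQuadForm Y p ≤ C)
    have h0 := intQuadForm_mul_snd hs p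
    have h1 := intQuadForm_mul_fst hs p
    simp only [Set.mem_ofPred_eq, Fin.forall_fin_two, Matrix.cons_val_zero, Matrix.cons_val_one]
    refine ⟨int_sq_le_mem_Icc ?_, int_sq_le_mem_Icc ?_⟩
    · rw [le_div_iff₀ hd]
      nlinarith [sq_nonneg (Y 0 1 * p 0 + Y 1 1 * p 1), mul_le_mul_of_nonneg_left hp hc.le]
    · rw [le_div_iff₀ hd]
      nlinarith [sq_nonneg (Y 0 0 * p 0 + Y 0 1 * p 1), mul_le_mul_of_nonneg_left hp ha.le]

theorem exists_intQuadForm_eq_firstMinimum {Y : Matrix (Fin 2) (Fin 2) ℝ} (hs : Y 1 0 = Y 0 1)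
    (ha : 0 < Y 0 0) (hd : 0 < Y.det) :
    ∃ p : Fin 2 → ℤ, p ≠ 0 ∧ intQuadForm Y p = firstMinimum Y ∧
      ∀ q : Fin 2 → ℤ, q ≠ 0 → intQuadForm Y p ≤ intQuadForm Y q := by
  let e : Fin 2 → ℤ := ![1, 0]
  have he : e ≠ 0 := fun h => one_ne_zero (congrFun h 0)
  obtain ⟨p, ⟨hp, hp0⟩, hmin⟩ := Set.exists_min_image
    ({p | intQuadForm Y p ≤ intQuadForm Y e} ∩ {p | p ≠ 0}) (intQuadForm Y)
    ((finite_setOf_intQuadForm_le hs ha hd _).inter_of_left _) ⟨e, by simp, he⟩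
  have hmin' : ∀ q : Fin 2 → ℤ, q ≠ 0 → intQuadForm Y p ≤ intQuadForm Y q := by
    intro q hq
    by_cases h : intQuadForm Y q ≤ intQuadForm Y e
    · exact hmin q ⟨h, hq⟩
    · exact le_trans hp (not_le.mp h).le
  refine ⟨p, hp0, ?_, hmin'⟩
  have : IsLeast {r | ∃ p : Fin 2 → ℤ, p ≠ 0 ∧ r = intQuadForm Y p} (intQuadForm Y p) := by
    refine ⟨⟨p, hp0, rfl⟩, ?_⟩
    rintro _ ⟨q, hq, rfl⟩
    exact hmin' q hq
  exact this.csInf_eq.symm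

theorem le_firstMinimum {Y : Matrix (Fin 2) (Fin 2) ℝ} {μ : ℝ}
    (h : ∀ p : Fin 2 → ℤ, p ≠ 0 → μ ≤ intQuadForm Y p) : μ ≤ firstMinimum Y := by
  refine le_csInf ⟨_, ![1, 0], fun h => one_ne_zero (congrFun h 0), rfl⟩ ?_
  rintro _ ⟨q, hq, rfl⟩
  exact h q hq

/-- A minimal vector of a binary form extends to a reduced basis. -/
theorem exists_reduced_basis {Y : Matrix (Fin 2) (Fin 2) ℝ} (hs : Y 1 0 = Y 0 1)
    (ha : 0 < Y 0 0) (hd : 0 < Y.det) {p : Fin 2 → ℤ} (hp : p ≠ 0)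
    (hmin : ∀ q : Fin 2 → ℤ, q ≠ 0 → intQuadForm Y p ≤ intQuadForm Y q) :
    ∃ q : Fin 2 → ℤ, p 0 * q 1 - p 1 * q 0 = 1 ∧
      intQuadForm Y q ≤ 4 / 3 * Y.det / intQuadForm Y p := by
  have hpos := intQuadForm_pos hs ha hd hp
  -- A minimal vector is primitive, since dividing it by the gcd of its entries would give a smaller
  -- value.
  obtain ⟨u, v, huv⟩ : ∃ u v : ℤ, u * p 0 + v * p 1 = 1 := by
    change IsCoprime (p 0) (p 1)
    rw [Int.isCoprime_iff_gcd_eq_one]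
    set g := Int.gcd (p 0) (p 1) with hg
    obtain ⟨x, hx⟩ : (g : ℤ) ∣ p 0 := Int.gcd_dvd_left ..
    obtain ⟨y, hy⟩ : (g : ℤ) ∣ p 1 := Int.gcd_dvd_right ..
    have hg0 : g ≠ 0 := by
      intro h
      rw [h] at hx hy
      rcases fin_two_ne_zero hp with h | h
      · exact h (by simpa using hx)
      · exact h (by simpa using hy)
    have hq : (![x, y] : Fin 2 → ℤ) ≠ 0 := by
      intro h
      have h0 : x = 0 := congrFun h 0
      have h1 : y = 0 := congrFun h 1
      rcases fin_two_ne_zero hp with h | h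
      · exact h (by simp [hx, h0])
      · exact h (by simp [hy, h1])
    have h1 := hmin _ hq
    have h2 := intQuadForm_pos hs ha hd hq
    have h3 : intQuadForm Y p = (g : ℝ) ^ 2 * intQuadForm Y ![x, y] := by
      rw [intQuadForm_eq hs, intQuadForm_eq hs, hx, hy]
      simp only [Matrix.cons_val_zero, Matrix.cons_val_one]
      push_cast; ring
    rw [h3] at h1
    have h4 : (g : ℝ) ^ 2 ≤ 1 := by
      by_contra! h
      nlinarith
    have h5 : g ^ 2 ≤ 1 := by exact_mod_cast h4
    have : g ≤ 1 := by nlinarith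
    omega
  -- `B` is the polar form paired with `p`; `hB` is the Gram determinant identity for the pair `p,
  -- q`.
  let B : (Fin 2 → ℤ) → ℝ := fun q =>
    Y 0 0 * p 0 * q 0 + Y 0 1 * (p 0 * q 1 + p 1 * q 0) + Y 1 1 * p 1 * q 1
  have hB : ∀ q, intQuadForm Y p * intQuadForm Y q =
      B q ^ 2 + Y.det * ((p 0 : ℝ) * q 1 - p 1 * q 0) ^ 2 := by
    intro q
    rw [intQuadForm_eq hs, intQuadForm_eq hs, Matrix.det_fin_two, hs]
    simp only [B]; ring
  -- Size reduction: subtracting the nearest multiple of `p` leaves `|B q|` at most half the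
  -- minimum.
  let k := round (B ![-v, u] / intQuadForm Y p)
  let q : Fin 2 → ℤ := ![-v - k * p 0, u - k * p 1]
  have hq1 : p 0 * q 1 - p 1 * q 0 = 1 := by
    simp only [q, Matrix.cons_val_zero, Matrix.cons_val_one]
    linear_combination huv
  have hq1' : (p 0 : ℝ) * q 1 - p 1 * q 0 = 1 := by exact_mod_cast hq1
  have hq0 : q ≠ 0 := by
    intro h
    simp [h] at hq1
  have hBq : B q = (B ![-v, u] / intQuadForm Y p - k) * intQuadForm Y p := by
    rw [sub_mul, div_mul_cancel₀ _ hpos.ne', intQuadForm_eq hs]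
    simp only [B, q, Matrix.cons_val_zero, Matrix.cons_val_one]
    push_cast; ring
  have hBq' : |B q| ≤ intQuadForm Y p / 2 := by
    rw [hBq, abs_mul, abs_of_pos hpos]
    have := abs_sub_round (B ![-v, u] / intQuadForm Y p)
    calc _ ≤ 1 / 2 * intQuadForm Y p := mul_le_mul_of_nonneg_right this hpos.le
      _ = _ := by ring
  refine ⟨q, hq1, ?_⟩
  -- Writing `Q` for the form, `Q(p)Q(q) = B(q)² + det Y ≤ Q(p)²/4 + det Y ≤ Q(p)Q(q)/4 + det Y`,
  -- whence the factor `4/3`.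
  have h1 := hB q
  rw [hq1', one_pow, mul_one] at h1
  have h2 := hmin q hq0
  have h3 : B q ^ 2 ≤ (intQuadForm Y p / 2) ^ 2 := sq_le_sq' (abs_le.mp hBq').1 (abs_le.mp hBq').2
  rw [le_div_iff₀ hpos]
  nlinarith

theorem linearIndependent_of_cross_eq_one {p q : Fin 2 → ℤ} (h : p 0 * q 1 - p 1 * q 0 = 1) :
    LinearIndependent ℤ ![p, q] := by
  rw [LinearIndependent.pair_iff]
  intro s t hst
  have h0 : s * p 0 + t * q 0 = 0 := congrFun hst 0
  have h1 : s * p 1 + t * q 1 = 0 := congrFun hst 1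
  constructor
  · linear_combination q 1 * h0 - q 0 * h1 - s * h
  · linear_combination p 0 * h1 - p 1 * h0 - t * h

theorem secondMinimum_le {Y : Matrix (Fin 2) (Fin 2) ℝ} (hs : Y 1 0 = Y 0 1)
    (ha : 0 < Y 0 0) (hd : 0 < Y.det) : secondMinimum Y ≤ 4 / 3 * Y.det / firstMinimum Y := by
  obtain ⟨p, hp, hpe, hmin⟩ := exists_intQuadForm_eq_firstMinimum hs ha hd
  obtain ⟨q, hq, hle⟩ := exists_reduced_basis hs ha hd hp hmin
  rw [← hpe]
  refine le_trans (csInf_le ⟨0, ?_⟩ ⟨p, q, hp, hpe, linearIndependent_of_cross_eq_one hq, rfl⟩) hle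
  rintro _ ⟨_, q, _, _, hli, rfl⟩
  exact (intQuadForm_pos hs ha hd (hli.ne_zero 1)).le

theorem firstMinimum_le_secondMinimum {Y : Matrix (Fin 2) (Fin 2) ℝ} (hs : Y 1 0 = Y 0 1)
    (ha : 0 < Y 0 0) (hd : 0 < Y.det) : firstMinimum Y ≤ secondMinimum Y := by
  obtain ⟨p, hp, hpe, hmin⟩ := exists_intQuadForm_eq_firstMinimum hs ha hd
  obtain ⟨q, hq, hle⟩ := exists_reduced_basis hs ha hd hp hmin
  refine le_csInf ⟨_, p, q, hp, hpe, linearIndependent_of_cross_eq_one hq, rfl⟩ ?_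
  rintro _ ⟨_, q, _, _, hli, rfl⟩
  rw [← hpe]
  exact hmin _ (hli.ne_zero 1)

theorem secondMinimum_le_of_le {Y : Matrix (Fin 2) (Fin 2) ℝ} (hs : Y 1 0 = Y 0 1)
    (ha : 0 < Y 0 0) (hd : 0 < Y.det) {μ : ℝ} (hμ : 0 < μ)
    (h : ∀ p : Fin 2 → ℤ, p ≠ 0 → μ ≤ intQuadForm Y p) :
    secondMinimum Y ≤ 4 / 3 * Y.det / μ :=
  (secondMinimum_le hs ha hd).trans
    (div_le_div_of_nonneg_left (by positivity) hμ (le_firstMinimum h))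

/-! ### Riemann forms and period matrices -/

namespace PrincipallyPolarizedAbelianVariety

variable {g : ℕ} (A : PrincipallyPolarizedAbelianVariety g)

theorem form_neg_swap (u v : Fin g → ℂ) : A.form u v = -A.form v u := by
  have h := A.form_alt (u + v)
  simp only [map_add, LinearMap.add_apply, A.form_alt] at h
  linarith

theorem form_I_left (u v : Fin g → ℂ) :
    A.form (Complex.I • u) v = -A.form u (Complex.I • v) := by
  rw [← A.form_I u (Complex.I • v), smul_smul, Complex.I_mul_I, neg_one_smul, map_neg, neg_neg]

theorem form_I_left_symm (u v : Fin g → ℂ) :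
    A.form (Complex.I • u) v = A.form (Complex.I • v) u := by
  rw [A.form_I_left, A.form_neg_swap, neg_neg]

/-- The Gram matrix of the real part `(u, v) ↦ E(iu, v)` of the Riemann form. -/
noncomputable def riemannGram {ι : Type*} (v : ι → Fin g → ℂ) : Matrix ι ι ℝ :=
  Matrix.of fun i j => A.form (Complex.I • v i) (v j)

theorem smul_eq_re_add_im (z : ℂ) (v : Fin g → ℂ) :
    z • v = z.re • v + z.im • (Complex.I • v) := by
  ext i
  simp only [Pi.smul_apply, Pi.add_apply, smul_eq_mul, Complex.real_smul]
  conv_lhs => rw [← Complex.re_add_im z]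
  ring

section PeriodMatrix

variable {A} {b : Module.Basis (Fin g ⊕ Fin g) ℤ A.lattice} {Z : Matrix (Fin g) (Fin g) ℂ}

theorem IsSymplecticBasis.form_apply (hb : A.IsSymplecticBasis b) (i j : Fin g ⊕ Fin g) :
    A.form (b i) (b j) = Matrix.fromBlocks 0 1 (-1) 0 i j := congrFun (congrFun hb i) j

theorem IsPeriodMatrix.eq_sum (hZ : A.IsPeriodMatrix b Z) (j : Fin g) :
    (b (Sum.inl j) : Fin g → ℂ) = ∑ i, ((Z i j).re • (b (Sum.inr i) : Fin g → ℂ) +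
      (Z i j).im • (Complex.I • (b (Sum.inr i) : Fin g → ℂ))) := by
  rw [hZ j]
  exact Finset.sum_congr rfl fun i _ => smul_eq_re_add_im _ _

/-- Expand `E(e_j, v_k) = δ_jk` with `e_j` written through the `v_i`; the real parts of `Z` drop out
because the `v_i` span an isotropic space. -/
theorem IsSymplecticBasis.transpose_im_mul_riemannGram (hb : A.IsSymplecticBasis b)
    (hZ : A.IsPeriodMatrix b Z) :
    (Z.map Complex.im).transpose * A.riemannGram (fun i => (b (Sum.inr i) : Fin g → ℂ)) = 1 := by
  ext j k
  have h := hb.form_apply (Sum.inl j) (Sum.inr k)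
  rw [hZ.eq_sum j] at h
  simp only [map_sum, map_add, map_smul, LinearMap.add_apply, LinearMap.sum_apply,
    LinearMap.smul_apply, hb.form_apply, Matrix.fromBlocks_apply₂₂, Matrix.zero_apply,
    Matrix.fromBlocks_apply₁₂, smul_eq_mul] at h
  simpa [Matrix.mul_apply, riemannGram] using h

theorem IsSymplecticBasis.riemannGram_mul_im (hb : A.IsSymplecticBasis b)
    (hZ : A.IsPeriodMatrix b Z) :
    A.riemannGram (fun i => (b (Sum.inr i) : Fin g → ℂ)) * Z.map Complex.im = 1 := by
  have h := congrArg Matrix.transpose (hb.transpose_im_mul_riemannGram hZ)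
  rw [Matrix.transpose_mul, Matrix.transpose_transpose, Matrix.transpose_one] at h
  rw [← h]
  congr 1
  ext i j
  exact A.form_I_left_symm _ _

theorem IsSymplecticBasis.im_mul_riemannGram (hb : A.IsSymplecticBasis b)
    (hZ : A.IsPeriodMatrix b Z) :
    Z.map Complex.im * A.riemannGram (fun i => (b (Sum.inr i) : Fin g → ℂ)) = 1 :=
  mul_eq_one_comm.mp (hb.riemannGram_mul_im hZ)

theorem IsSymplecticBasis.im_isSymm (hb : A.IsSymplecticBasis b) (hZ : A.IsPeriodMatrix b Z) :
    (Z.map Complex.im).IsSymm :=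
  calc (Z.map Complex.im).transpose
      = (Z.map Complex.im).transpose *
          (A.riemannGram (fun i => (b (Sum.inr i) : Fin g → ℂ)) * Z.map Complex.im) := by
        rw [hb.riemannGram_mul_im hZ, mul_one]
    _ = Z.map Complex.im := by
        rw [← mul_assoc, hb.transpose_im_mul_riemannGram hZ, one_mul]

theorem riemannGram_dotProduct {ι : Type*} [Fintype ι] (v : ι → Fin g → ℂ) (x y : ι → ℝ) :
    x ⬝ᵥ (A.riemannGram v).mulVec y =
      A.form (Complex.I • ∑ i, x i • v i) (∑ i, y i • v i) := by
  simp only [dotProduct, Matrix.mulVec, riemannGram, Matrix.of_apply, Finset.smul_sum, map_sum,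
    LinearMap.sum_apply, map_smul, smul_eq_mul, LinearMap.smul_apply, smul_comm Complex.I,
    Finset.mul_sum]
  rw [Finset.sum_comm]
  exact Finset.sum_congr rfl fun i _ => Finset.sum_congr rfl fun j _ => by ring

theorem linearIndependent_coe_basis {ι : Type*} [Finite ι]
    (b : Module.Basis ι ℤ A.lattice) : LinearIndependent ℝ (fun i => (b i : Fin g → ℂ)) := by
  have := A.discrete
  have := A.isZLattice
  have h := (b.ofZLatticeBasis ℝ A.lattice).linearIndependent
  convert! h using 1
  ext i : 1
  exact (b.ofZLatticeBasis_apply ℝ A.lattice i).symm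

theorem riemannGram_posDef {ι : Type*} [Fintype ι] {v : ι → Fin g → ℂ}
    (hv : LinearIndependent ℝ v) : (A.riemannGram v).PosDef := by
  refine Matrix.PosDef.of_dotProduct_mulVec_pos ?_ ?_
  · ext i j
    simpa [riemannGram] using A.form_I_left_symm _ _
  · intro x hx
    rw [star_trivial, riemannGram_dotProduct]
    refine A.form_pos _ fun h => hx ?_
    exact funext (Fintype.linearIndependent_iff.mp hv x h)

theorem IsSymplecticBasis.im_posDef (hb : A.IsSymplecticBasis b) (hZ : A.IsPeriodMatrix b Z) :
    (Z.map Complex.im).PosDef := by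
  have hv : LinearIndependent ℝ (fun i : Fin g => (b (Sum.inr i) : Fin g → ℂ)) :=
    (linearIndependent_coe_basis b).comp Sum.inr Sum.inr_injective
  have h := (riemannGram_posDef (A := A) hv).inv
  rwa [Matrix.inv_eq_left_inv (hb.im_mul_riemannGram hZ)] at h

/-- Symmetry of the real part is the content of `E(e_j, e_k) = 0`: expanding `e_k` gives `Re Z_jk`
minus an entry of `(Re Z)ᵗ H Im Z = (Re Z)ᵗ`, where `H` is the Gram matrix inverse to `Im Z`. -/
theorem IsSymplecticBasis.mem_siegelUpperHalfSpace (hb : A.IsSymplecticBasis b)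
    (hZ : A.IsPeriodMatrix b Z) : Z ∈ siegelUpperHalfSpace g := by
  refine ⟨?_, hb.im_posDef hZ⟩
  have hre : (Z.map Complex.re).IsSymm := by
    ext j k
    have h := hb.form_apply (Sum.inl j) (Sum.inl k)
    have h1 : ∀ l, A.form (b (Sum.inl j)) (Complex.I • (b (Sum.inr l) : Fin g → ℂ)) =
        -((Z.map Complex.re).transpose *
          A.riemannGram (fun i => (b (Sum.inr i) : Fin g → ℂ))) j l := by
      intro l
      rw [hZ.eq_sum j]
      simp only [map_sum, map_add, map_smul, LinearMap.add_apply, LinearMap.sum_apply,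
        LinearMap.smul_apply, A.form_I, hb.form_apply, Matrix.fromBlocks_apply₂₂,
        Matrix.zero_apply, smul_eq_mul, Matrix.mul_apply, riemannGram,
        Matrix.transpose_apply, Matrix.map_apply, Matrix.of_apply, ← Finset.sum_neg_distrib]
      exact Finset.sum_congr rfl fun i _ => by rw [A.form_I_left]; ring
    rw [hZ.eq_sum k] at h
    simp only [map_sum, map_add, map_smul, hb.form_apply, h1, smul_eq_mul,
      Matrix.fromBlocks_apply₁₁, Matrix.fromBlocks_apply₁₂, Matrix.zero_apply,
      Finset.sum_add_distrib, mul_neg, Finset.sum_neg_distrib] at h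
    have h2 : ∑ l, (Z l k).im * ((Z.map Complex.re).transpose *
        A.riemannGram (fun i => (b (Sum.inr i) : Fin g → ℂ))) j l = (Z k j).re := by
      have h3 := congrFun (congrFun (mul_assoc (Z.map Complex.re).transpose
        (A.riemannGram (fun i => (b (Sum.inr i) : Fin g → ℂ))) (Z.map Complex.im)) j) k
      rw [hb.riemannGram_mul_im hZ, mul_one, Matrix.mul_apply] at h3
      rw [Matrix.transpose_apply, Matrix.map_apply] at h3
      rw [← h3]
      exact Finset.sum_congr rfl fun l _ => mul_comm _ _
    rw [h2] at h
    simp only [Matrix.one_apply, mul_ite, mul_one, mul_zero, Finset.sum_ite_eq,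
      Finset.mem_univ, if_true] at h
    simp only [Matrix.transpose_apply, Matrix.map_apply]
    linarith
  have him := hb.im_isSymm hZ
  ext j k
  exact Complex.ext (congrFun (congrFun hre j) k) (congrFun (congrFun him j) k)

/-- The `v_i` are a complex basis: if `x + iy = 0` with `x, y` in their real span, then isotropy
gives `0 = E(x, y) = -E(iy, y)`, so positivity forces `y = 0`. -/
theorem IsSymplecticBasis.exists_isPeriodMatrix (hb : A.IsSymplecticBasis b) :
    ∃ Z, A.IsPeriodMatrix b Z := by
  have hv : LinearIndependent ℝ (fun i : Fin g => (b (Sum.inr i) : Fin g → ℂ)) :=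
    (linearIndependent_coe_basis b).comp Sum.inr Sum.inr_injective
  have hvC : LinearIndependent ℂ (fun i : Fin g => (b (Sum.inr i) : Fin g → ℂ)) := by
    rw [Fintype.linearIndependent_iff] at hv ⊢
    intro c hc
    replace hc : ∑ i, (c i).re • (b (Sum.inr i) : Fin g → ℂ) +
        Complex.I • ∑ i, (c i).im • (b (Sum.inr i) : Fin g → ℂ) = 0 := by
      rw [← hc, Finset.smul_sum, ← Finset.sum_add_distrib]
      exact Finset.sum_congr rfl fun i _ => by rw [smul_eq_re_add_im (c i), smul_comm]
    have h0 : A.form (∑ i, (c i).re • (b (Sum.inr i) : Fin g → ℂ))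
        (∑ i, (c i).im • (b (Sum.inr i) : Fin g → ℂ)) = 0 := by
      simp [hb.form_apply]
    rw [add_eq_zero_iff_eq_neg] at hc
    have him : ∑ i, (c i).im • (b (Sum.inr i) : Fin g → ℂ) = 0 := by
      by_contra h
      have := A.form_pos _ h
      rw [hc, map_neg, LinearMap.neg_apply] at h0
      linarith
    rw [him, smul_zero, neg_zero] at hc
    intro i
    exact Complex.ext (hv _ hc i) (hv _ him i)
  let B := basisOfLinearIndependentOfCardEqFinrank' _ hvC (by simp)
  refine ⟨Matrix.of fun i j => B.repr (b (Sum.inl j)) i, fun j => ?_⟩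
  conv_lhs => rw [← B.sum_repr (b (Sum.inl j) : Fin g → ℂ)]
  simp [B]

end PeriodMatrix

section Surface

variable {A : PrincipallyPolarizedAbelianVariety 2} {b : Module.Basis (Fin 2 ⊕ Fin 2) ℤ A.lattice}
  {Z : Matrix (Fin 2) (Fin 2) ℂ}

theorem IsSymplecticBasis.det_im_mul (hb : A.IsSymplecticBasis b) (hZ : A.IsPeriodMatrix b Z) :
    (Z.map Complex.im).det *
      (A.riemannGram (fun i => (b (Sum.inr i) : Fin 2 → ℂ))).det = 1 := by
  rw [← Matrix.det_mul, hb.im_mul_riemannGram hZ, Matrix.det_one]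

/-- For a `2 × 2` matrix the inverse is the adjugate up to the determinant, so passing from `Y` to
the Gram matrix `Y⁻¹` amounts to turning `p` into `(p₁, -p₀)`. -/
theorem IsSymplecticBasis.intQuadForm_im (hb : A.IsSymplecticBasis b)
    (hZ : A.IsPeriodMatrix b Z) (p : Fin 2 → ℤ) :
    intQuadForm (Z.map Complex.im) p = (Z.map Complex.im).det *
      A.form (Complex.I • ((p 1 • b (Sum.inr 0) - p 0 • b (Sum.inr 1) : A.lattice) : Fin 2 → ℂ))
        ((p 1 • b (Sum.inr 0) - p 0 • b (Sum.inr 1) : A.lattice) : Fin 2 → ℂ) := by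
  have hd := hb.det_im_mul hZ
  have hs : (Z.map Complex.im) 1 0 = (Z.map Complex.im) 0 1 :=
    (hb.im_isSymm hZ).apply 0 1
  have hadj : A.riemannGram (fun i => (b (Sum.inr i) : Fin 2 → ℂ)) =
      (A.riemannGram (fun i => (b (Sum.inr i) : Fin 2 → ℂ))).det •
        (Z.map Complex.im).adjugate := by
    set H := A.riemannGram (fun i => (b (Sum.inr i) : Fin 2 → ℂ))
    set Y := Z.map Complex.im
    have h : Y.adjugate = Y.det • H := by
      rw [← one_mul Y.adjugate, ← hb.riemannGram_mul_im hZ, mul_assoc, Matrix.mul_adjugate,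
        Matrix.mul_smul, mul_one]
    rw [h, smul_smul, mul_comm, hd, one_smul]
  have hcoe : ((p 1 • b (Sum.inr 0) - p 0 • b (Sum.inr 1) : A.lattice) : Fin 2 → ℂ) =
      ∑ i, ![(p 1 : ℝ), -(p 0 : ℝ)] i • (b (Sum.inr i) : Fin 2 → ℂ) := by
    simp only [Fin.sum_univ_two, Matrix.cons_val_zero, Matrix.cons_val_one, neg_smul,
      Int.cast_smul_eq_zsmul]
    exact sub_eq_add_neg _ _
  rw [hcoe, ← riemannGram_dotProduct, intQuadForm_eq hs]
  set H := A.riemannGram (fun i => (b (Sum.inr i) : Fin 2 → ℂ))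
  set Y := Z.map Complex.im
  have h00 : H 0 0 = H.det * Y 1 1 := by
    simpa [Matrix.adjugate_fin_two] using congrFun (congrFun hadj 0) 0
  have h01 : H 0 1 = -(H.det * Y 0 1) := by
    simpa [Matrix.adjugate_fin_two] using congrFun (congrFun hadj 0) 1
  have h10 : H 1 0 = -(H.det * Y 0 1) := by
    simpa [Matrix.adjugate_fin_two, hs] using congrFun (congrFun hadj 1) 0
  have h11 : H 1 1 = H.det * Y 0 0 := by
    simpa [Matrix.adjugate_fin_two] using congrFun (congrFun hadj 1) 1
  simp only [dotProduct, Matrix.mulVec, Fin.sum_univ_two, Matrix.cons_val_zero,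
    Matrix.cons_val_one, h00, h01, h10, h11]
  linear_combination (-(Y 0 0 * p 0 ^ 2 + 2 * Y 0 1 * p 0 * p 1 + Y 1 1 * p 1 ^ 2)) * hd

end Surface

end PrincipallyPolarizedAbelianVariety

/-! ### Discriminants in terms of complex embeddings -/

theorem NumberField.discr_eq_det_sq {L : Type*} [Field L] [NumberField L] {ι : Type*} [Fintype ι]
    [DecidableEq ι] (e : ι ≃ (L →ₐ[ℚ] ℂ)) (b : Module.Basis ι ℤ (𝓞 L)) :
    (discr L : ℂ) = (Matrix.of fun i j => e j (b i : L)).det ^ 2 := by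
  have h := Algebra.discr_eq_det_embeddingsMatrixReindex_pow_two ℚ ℂ
    (b.localizationLocalization ℚ (nonZeroDivisors ℤ) L) e
  rw [Algebra.discr_localizationLocalization, discr_eq_discr] at h
  have h' : (discr L : ℂ) = ((Matrix.of fun i (σ : L →ₐ[ℚ] ℂ) => σ (b i : L)).submatrix
      id e).det ^ 2 := by
    simpa [Algebra.embeddingsMatrixReindex, Algebra.embeddingsMatrix, Matrix.reindex_apply] using h
  exact h'

/-- The bases of `I` and `𝓞 L` differ by an integral matrix of determinant `± N(I)`. -/
theorem NumberField.absNorm_sq_mul_discr {L : Type*} [Field L] [NumberField L] {ι : Type*}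
    [Fintype ι] [DecidableEq ι] (e : ι ≃ (L →ₐ[ℚ] ℂ)) (I : Ideal (𝓞 L))
    (b : Module.Basis ι ℤ (𝓞 L)) (bI : Module.Basis ι ℤ I) :
    (Ideal.absNorm I : ℂ) ^ 2 * (discr L : ℂ) =
      (Matrix.of fun i j => e j ((bI i : 𝓞 L) : L)).det ^ 2 := by
  have hP : (Matrix.of fun i j => e j ((bI i : 𝓞 L) : L)) =
      ((b.toMatrix fun i => (bI i : 𝓞 L)).transpose.map (Int.cast : ℤ → ℂ)) *
        (Matrix.of fun i j => e j (b i : L)) := by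
    ext i j
    have h := congrArg (fun x : 𝓞 L => e j (x : L)) (b.sum_repr (bI i : 𝓞 L))
    simp only [Matrix.mul_apply, Matrix.of_apply, Matrix.map_apply, Matrix.transpose_apply,
      Module.Basis.toMatrix_apply]
    rw [← h]
    simp
  have hN : ((b.toMatrix fun i => (bI i : 𝓞 L)).det) ^ 2 = (Ideal.absNorm I : ℤ) ^ 2 := by
    rw [← Ideal.natAbs_det_basis_change b I bI, Int.natCast_natAbs, sq_abs]
    rfl
  rw [hP, Matrix.det_mul, mul_pow, ← NumberField.discr_eq_det_sq e b]
  congr 1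
  have h2 : ((b.toMatrix fun i => (bI i : 𝓞 L)).transpose.map (Int.cast : ℤ → ℂ)).det =
      ((b.toMatrix fun i => (bI i : 𝓞 L)).det : ℂ) := by
    rw [← Matrix.det_transpose (b.toMatrix fun i => (bI i : 𝓞 L))]
    exact ((Int.castRingHom ℂ).map_det _).symm
  rw [h2]
  exact_mod_cast congrArg (Int.cast : ℤ → ℂ) hN.symm

/-! ### Primitive quartic CM fields -/

namespace IsPrimitiveQuarticCMField

variable {K : Type*} [Field K] [NumberField K]

/-- The only place where the absence of imaginary quadratic subfields enters: a square root of a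
negative rational would generate one. -/
theorem nonneg_of_sq_eq (hK : IsPrimitiveQuarticCMField K) {s : K} {q : ℚ}
    (h : s ^ 2 = algebraMap ℚ K q) : 0 ≤ q := by
  by_contra! hq
  have hint : IsIntegral ℚ s := Algebra.IsIntegral.isIntegral s
  have hF : Module.finrank ℚ (IntermediateField.adjoin ℚ {s}) = 2 := by
    rw [IntermediateField.adjoin.finrank hint]
    apply le_antisymm
    · have hdvd : minpoly ℚ s ∣ Polynomial.X ^ 2 - Polynomial.C q :=
        minpoly.dvd _ _ (by simp [h])
      have := Polynomial.natDegree_le_of_dvd hdvd (Polynomial.X_pow_sub_C_ne_zero two_pos q)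
      rwa [Polynomial.natDegree_X_pow_sub_C] at this
    · rw [minpoly.two_le_natDegree_iff hint]
      rintro ⟨r, rfl⟩
      rw [← map_pow] at h
      have := (algebraMap ℚ K).injective h
      nlinarith [sq_nonneg r]
  refine hK.2.2 _ hF ⟨fun v => ?_⟩
  rw [← InfinitePlace.not_isReal_iff_isComplex]
  intro hv
  have h1 : (⟨s, IntermediateField.mem_adjoin_simple_self ℚ s⟩ :
      IntermediateField.adjoin ℚ {s}) ^ 2 = algebraMap ℚ _ q := Subtype.ext h
  have h2 := congrArg (InfinitePlace.embedding_of_isReal hv) h1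
  rw [map_pow, eq_ratCast, map_ratCast] at h2
  have h3 : (q : ℝ) < 0 := by exact_mod_cast hq
  nlinarith [sq_nonneg (InfinitePlace.embedding_of_isReal hv
    ⟨s, IntermediateField.mem_adjoin_simple_self ℚ s⟩)]

theorem finrank_maximalRealSubfield (hK : IsPrimitiveQuarticCMField K) :
    Module.finrank ℚ (maximalRealSubfield K) = 2 := by
  have := hK.1
  have h := Module.finrank_mul_finrank ℚ (maximalRealSubfield K) K
  rw [hK.2.1, Algebra.IsQuadraticExtension.finrank_eq_two (maximalRealSubfield K) K] at h
  omega

theorem abs_discr_eq (hK : IsPrimitiveQuarticCMField K) :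
    |discr K| = realSubfieldDiscr K ^ 2 * relDiscrNorm K := by
  have := hK.1
  have h := natAbs_discr_eq_absNorm_differentIdeal_mul_natAbs_discr_pow (maximalRealSubfield K)
    (𝓞 (maximalRealSubfield K)) K (𝓞 K)
  rw [Algebra.IsQuadraticExtension.finrank_eq_two (maximalRealSubfield K) K] at h
  rw [relDiscrNorm, relDiscrIdeal, Ideal.absNorm_relNorm, Int.abs_eq_natAbs, h]
  push_cast
  rw [sq_abs, mul_comm]
  rfl

theorem exists_complexConj_eq_neg (hK : IsPrimitiveQuarticCMField K) :
    have := hK.1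
    ∃ T : 𝓞 K, T ≠ 0 ∧ IsCMField.complexConj K T = -T := by
  have := hK.1
  obtain ⟨x, hx⟩ : ∃ x : 𝓞 K, IsCMField.ringOfIntegersComplexConj K x ≠ x := by
    by_contra! h
    refine IsCMField.complexConj_ne_one K (AlgEquiv.ext fun y => ?_)
    obtain ⟨a, b, hb, rfl⟩ := IsFractionRing.div_surjective (A := 𝓞 K) y
    have ha' := congrArg (algebraMap (𝓞 K) K) (h a)
    have hb' := congrArg (algebraMap (𝓞 K) K) (h b)
    simp only [IsCMField.coe_ringOfIntegersComplexConj] at ha' hb'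
    rw [map_div₀, ha', hb', AlgEquiv.one_apply]
  refine ⟨x - IsCMField.ringOfIntegersComplexConj K x, sub_ne_zero.mpr hx.symm, ?_⟩
  simp

/-- A purely imaginary integer of `K` whose square generates the real quadratic subfield. -/
theorem exists_imaginary_integer (hK : IsPrimitiveQuarticCMField K) :
    ∃ (T : 𝓞 K) (t n : ℤ), (T : K) ^ 4 - t * (T : K) ^ 2 + n = 0 ∧
      (∀ q : ℚ, (T : K) ^ 2 ≠ q) ∧
      ∀ φ : K →+* ℂ, ∃ h : ℝ, h ≠ 0 ∧ φ T = Complex.I * h := by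
  have := hK.1
  obtain ⟨T, hT0, hT⟩ := hK.exists_complexConj_eq_neg
  have him : ∀ φ : K →+* ℂ, ∃ h : ℝ, h ≠ 0 ∧ φ T = Complex.I * h := by
    intro φ
    have h1 := IsCMField.complexEmbedding_complexConj K φ T
    rw [hT, map_neg] at h1
    have h2 : (φ T).re = 0 := by
      have := congrArg Complex.re h1
      simp only [Complex.neg_re, Complex.conj_re] at this
      linarith
    have h3 : φ T = Complex.I * (φ T).im := by
      apply Complex.ext <;> simp [h2]
    refine ⟨(φ T).im, fun h => hT0 ?_, h3⟩
    rw [h, Complex.ofReal_zero, mul_zero, map_eq_zero] at h3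
    exact RingOfIntegers.ext h3
  have hq : ∀ q : ℚ, (T : K) ^ 2 ≠ q := by
    intro q hq
    have h1 := hK.nonneg_of_sq_eq (s := (T : K)) (q := q) hq
    obtain ⟨φ⟩ : Nonempty (K →+* ℂ) := inferInstance
    obtain ⟨h, hh, hφ⟩ := him φ
    have h2 := congrArg φ hq
    rw [map_pow, hφ, mul_pow, Complex.I_sq, map_ratCast] at h2
    have h3 : -1 * h ^ 2 = (q : ℝ) := by exact_mod_cast h2
    have h4 : (0 : ℝ) ≤ q := by exact_mod_cast h1
    have : 0 < h ^ 2 := by positivity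
    linarith
  have hmem : (T : K) ^ 2 ∈ maximalRealSubfield K := by
    rw [← IsCMField.complexConj_eq_self_iff, map_pow, hT, neg_sq]
  let S : maximalRealSubfield K := ⟨(T : K) ^ 2, hmem⟩
  have hint : IsIntegral ℚ S := Algebra.IsIntegral.isIntegral S
  have hdeg : (minpoly ℚ S).natDegree = 2 := by
    apply le_antisymm
    · exact hK.finrank_maximalRealSubfield ▸ minpoly.natDegree_le S
    · rw [minpoly.two_le_natDegree_iff hint]
      rintro ⟨r, hr⟩
      exact hq r (by simpa [S] using (congrArg Subtype.val hr).symm)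
  have hmin := minpoly.aeval ℚ S
  have hmon := minpoly.monic hint
  rw [Polynomial.aeval_eq_sum_range, hdeg, Finset.sum_range_succ, Finset.sum_range_succ,
    Finset.sum_range_one] at hmin
  rw [Polynomial.Monic, Polynomial.leadingCoeff, hdeg] at hmon
  rw [hmon] at hmin
  have hintZ : IsIntegral ℤ S := by
    apply (isIntegral_algebraMap_iff
      (FaithfulSMul.algebraMap_injective (maximalRealSubfield K) K)).mp
    exact T.isIntegral_coe.pow 2
  simp only [minpoly.isIntegrallyClosed_eq_field_fractions' ℚ hintZ, Polynomial.coeff_map] at hmin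
  refine ⟨T, -(minpoly ℤ S).coeff 1, (minpoly ℤ S).coeff 0, ?_, hq, him⟩
  have := congrArg (fun x : maximalRealSubfield K => (x : K)) hmin
  simp [Algebra.smul_def, S] at this
  push_cast
  linear_combination this

/-- Vieta's formulas: `-h₀²` and `-h₁²` are two distinct roots of `X² - tX + n`. -/
theorem trace_eq_and_norm_eq {T : 𝓞 K} {t n : ℤ} {σ : Fin 2 → K →+* ℂ} {h : Fin 2 → ℝ}
    (hT : (T : K) ^ 4 - t * (T : K) ^ 2 + n = 0) (hσ : ∀ k, σ k T = Complex.I * h k)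
    (hne : h 0 ^ 2 ≠ h 1 ^ 2) :
    (t : ℝ) = -(h 0 ^ 2 + h 1 ^ 2) ∧ (n : ℝ) = h 0 ^ 2 * h 1 ^ 2 := by
  have key : ∀ k, h k ^ 4 + t * h k ^ 2 + n = 0 := by
    intro k
    have h1 := congrArg (σ k) hT
    simp only [map_add, map_sub, map_mul, map_pow, map_intCast, hσ, map_zero, mul_pow,
      Complex.I_sq, Complex.I_pow_four] at h1
    have h2 : 1 * h k ^ 4 - t * (-1 * h k ^ 2) + n = 0 := by exact_mod_cast h1
    linarith
  have h0 := key 0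
  have h1 := key 1
  have ht : (t : ℝ) = -(h 0 ^ 2 + h 1 ^ 2) := by
    apply mul_left_cancel₀ (sub_ne_zero.mpr hne)
    linear_combination h0 - h1
  refine ⟨ht, ?_⟩
  rw [ht] at h0
  linear_combination h0

/-- If `h₀h₁ = q` were rational, then `T - q/T` would map to `i(h₀ + h₁)` and have the rational
square `t - 2q = -(h₀ + h₁)² ≤ 0`. By primitivity it vanishes, contradicting `h₀² ≠ h₁²`. -/
theorem mul_ne_ratCast (hK : IsPrimitiveQuarticCMField K) {T : 𝓞 K} {t n : ℤ}
    {σ : Fin 2 → K →+* ℂ} {h : Fin 2 → ℝ}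
    (hT : (T : K) ^ 4 - t * (T : K) ^ 2 + n = 0) (hσ : ∀ k, σ k T = Complex.I * h k)
    (hne : h 0 ^ 2 ≠ h 1 ^ 2) (h0 : h 0 ≠ 0) (q : ℚ) : h 0 * h 1 ≠ q := by
  intro hq
  obtain ⟨ht, hn⟩ := trace_eq_and_norm_eq hT hσ hne
  have hT0 : (T : K) ≠ 0 := by
    intro h'
    have h1 := hσ 0
    rw [h', map_zero, eq_comm, mul_eq_zero] at h1
    rcases h1 with h1 | h1
    · exact Complex.I_ne_zero h1
    · exact h0 (by exact_mod_cast h1)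
  have hs : σ 0 ((T : K) - q / T) = Complex.I * (h 0 + h 1 : ℝ) := by
    have h0' : (h 0 : ℂ) ≠ 0 := by exact_mod_cast h0
    rw [map_sub, map_div₀, map_ratCast, hσ]
    have hq' : (q : ℂ) = h 0 * h 1 := by exact_mod_cast hq.symm
    rw [hq']
    field_simp
    push_cast
    linear_combination (h 1 : ℂ) * (-Complex.I_sq)
  have hs2 : ((T : K) - q / T) ^ 2 = algebraMap ℚ K (t - 2 * q) := by
    apply (σ 0).injective
    rw [map_pow, hs, mul_pow, Complex.I_sq, eq_ratCast, map_ratCast]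
    have : -1 * (h 0 + h 1) ^ 2 = ((t - 2 * q : ℚ) : ℝ) := by
      push_cast
      rw [ht, ← hq]
      ring
    exact_mod_cast this
  have hnn := hK.nonneg_of_sq_eq hs2
  have hnn' : (0 : ℝ) ≤ t - 2 * q := by exact_mod_cast hnn
  rw [ht, ← hq] at hnn'
  have : (h 0 + h 1) ^ 2 = 0 := le_antisymm (by linarith) (sq_nonneg _)
  have h2 : h 0 + h 1 = 0 := by simpa using this
  apply hne
  rw [eq_neg_of_add_eq_zero_left h2, neg_sq]

end IsPrimitiveQuarticCMField

/-! ### Coordinates on a CM abelian surface -/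

/-- Coordinates on `ℂ²` in which the ring of integers of `K` acts diagonally through two complex
embeddings that differ on the real subfield, and the polarization is the standard one. -/
structure CMCoordinates {K : Type*} [Field K] [NumberField K]
    (A : PrincipallyPolarizedAbelianVariety 2) (φ : 𝓞 K →+* complexTorusEnd A.lattice) where
  /-- the coordinate map -/
  coord : (Fin 2 → ℂ) ≃ₗ[ℂ] (Fin 2 → ℂ)
  /-- the two embeddings of the CM type -/
  embedding : Fin 2 → K →+* ℂ
  embedding_ne : ∃ a : maximalRealSubfield K, embedding 0 a ≠ embedding 1 a
  coord_act : ∀ (α : 𝓞 K) (x : Fin 2 → ℂ) (k : Fin 2),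
    coord ((φ α : Module.End ℂ (Fin 2 → ℂ)) x) k = embedding k α * coord x k
  form_eq : ∀ x y : Fin 2 → ℂ,
    A.form x y = ∑ k, (coord x k * (starRingEnd ℂ) (coord y k)).im

namespace PrincipallyPolarizedAbelianVariety

theorem form_smul_smul {g : ℕ} (A : PrincipallyPolarizedAbelianVariety g) (a b : ℂ)
    (u : Fin g → ℂ) :
    A.form (a • u) (b • u) = (a * (starRingEnd ℂ) b).im * A.form (Complex.I • u) u := by
  rw [smul_eq_re_add_im a, smul_eq_re_add_im b]
  simp only [map_add, map_smul, LinearMap.add_apply, LinearMap.smul_apply, A.form_alt,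
    smul_eq_mul, Complex.mul_im, Complex.conj_re, Complex.conj_im]
  have h := A.form_I_left u u
  rw [show A.form u (Complex.I • u) = -A.form (Complex.I • u) u by rw [h, neg_neg]]
  ring

theorem form_imaginary_smul {g : ℕ} (A : PrincipallyPolarizedAbelianVariety g) (r s : ℝ)
    (u v : Fin g → ℂ) :
    A.form ((Complex.I * r) • u) ((Complex.I * s) • v) = r * s * A.form u v := by
  have h : ∀ (r : ℝ) (u : Fin g → ℂ), (Complex.I * r) • u = Complex.I • (r • u) := by
    intro r u
    ext i
    simp [mul_assoc]
  rw [h, h, A.form_I, map_smul, map_smul, LinearMap.smul_apply, smul_eq_mul, smul_eq_mul]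
  ring

theorem exists_basis_det_eq_one (A : PrincipallyPolarizedAbelianVariety 2) :
    ∃ b : Module.Basis (Fin 4) ℤ A.lattice,
      (Matrix.of fun i j => A.form (b i) (b j)).det = 1 := A.form_principal

/-- A real scalar preserving `Λ` is an integer, as seen from its coordinate on a basis vector;
injectivity of `φ` would then make `α` an integer. -/
theorem act_ne_real_smul {K : Type*} [Field K] {A : PrincipallyPolarizedAbelianVariety 2}
    {φ : 𝓞 K →+* complexTorusEnd A.lattice} (hφ : Function.Injective φ) {α : 𝓞 K}
    (hα : ∀ q : ℚ, (α : K) ≠ q) (r : ℝ) : (φ α : Module.End ℂ (Fin 2 → ℂ)) ≠ algebraMap ℂ _ (r : ℂ) := by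
  intro h
  obtain ⟨b, -⟩ := A.exists_basis_det_eq_one
  have hd := A.discrete
  have hz := A.isZLattice
  let x : A.lattice := ⟨(φ α : Module.End ℂ (Fin 2 → ℂ)) (b 0), (φ α).2 _ (b 0).2⟩
  have hx : (x : Fin 2 → ℂ) = r • (b 0 : Fin 2 → ℂ) := by
    simp only [x, h]
    ext i
    simp
  have h1 := b.ofZLatticeBasis_repr_apply ℝ A.lattice x 0
  rw [hx, map_smul, ← b.ofZLatticeBasis_apply ℝ A.lattice, Module.Basis.repr_self] at h1
  simp only [Finsupp.smul_apply, Finsupp.single_eq_same, smul_eq_mul, mul_one] at h1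
  have h2 : φ α = φ (b.repr x 0 : ℤ) := by
    apply Subtype.ext
    rw [h, h1, map_intCast]
    simp
  exact hα (b.repr x 0 : ℤ) (by simpa using congrArg (algebraMap (𝓞 K) K) (hφ h2))

/-- The operator is killed by `(X - s₀)(X - s₁)` and is not scalar, so the image of each factor
contains an eigenvector for the other root. -/
theorem exists_eigenbasis {K : Type*} [Field K] {A : PrincipallyPolarizedAbelianVariety 2}
    {φ : 𝓞 K →+* complexTorusEnd A.lattice}
    (hφ : Function.Injective φ) {α : 𝓞 K} (hα : ∀ q : ℚ, (α : K) ≠ q)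
    {s : Fin 2 → ℝ} (hs : s 0 ≠ s 1) {t n : ℤ} (ht : (t : ℝ) = s 0 + s 1)
    (hn : (n : ℝ) = s 0 * s 1) (heq : α ^ 2 - t * α + n = 0) :
    ∃ β : Module.Basis (Fin 2) ℂ (Fin 2 → ℂ),
      ∀ k, (φ α : Module.End ℂ (Fin 2 → ℂ)) (β k) = (s k : ℂ) • β k := by
  set f : Module.End ℂ (Fin 2 → ℂ) := (φ α).1 with hf
  have hfeq : f ^ 2 - (t : Module.End ℂ (Fin 2 → ℂ)) * f + n = 0 := by
    have := congrArg (fun x => ((φ x : complexTorusEnd A.lattice) :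
      Module.End ℂ (Fin 2 → ℂ))) heq
    simpa using this
  have hev : ∀ {a b : ℝ}, (t : ℝ) = a + b → (n : ℝ) = a * b →
      ∃ u : Fin 2 → ℂ, u ≠ 0 ∧ f u = (a : ℂ) • u := by
    intro a b hab hab'
    have hne := act_ne_real_smul hφ hα b
    rw [← hf] at hne
    obtain ⟨x, hx⟩ : ∃ x, f x ≠ (b : ℂ) • x := by
      by_contra! h
      exact hne (LinearMap.ext fun x => by rw [h x]; rfl)
    refine ⟨f x - (b : ℂ) • x, sub_ne_zero.mpr hx, ?_⟩
    have h1 := LinearMap.congr_fun hfeq x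
    have ht' : ((t : Module.End ℂ (Fin 2 → ℂ)) * f) x = (t : ℂ) • f x := by
      rw [Module.End.mul_apply, Module.End.intCast_apply, Int.cast_smul_eq_zsmul]
    have hn' : (n : Module.End ℂ (Fin 2 → ℂ)) x = (n : ℂ) • x := by
      rw [Module.End.intCast_apply, Int.cast_smul_eq_zsmul]
    have htc : (t : ℂ) = a + b := by exact_mod_cast congrArg ((↑) : ℝ → ℂ) hab
    have hnc : (n : ℂ) = a * b := by exact_mod_cast congrArg ((↑) : ℝ → ℂ) hab'
    rw [LinearMap.add_apply, LinearMap.sub_apply, ht', hn', sq, Module.End.mul_apply, htc, hnc,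
      LinearMap.zero_apply] at h1
    rw [map_sub, map_smul, ← sub_eq_zero, ← h1]
    module
  obtain ⟨u, hu, hfu⟩ := hev ht hn
  obtain ⟨v, hv, hfv⟩ := hev (ht.trans (add_comm _ _)) (hn.trans (mul_comm _ _))
  have hsC : (s 0 : ℂ) - s 1 ≠ 0 := sub_ne_zero.mpr (by exact_mod_cast hs)
  have hli : LinearIndependent ℂ ![u, v] := by
    rw [LinearIndependent.pair_iff]
    intro a b hab
    have h1 := congrArg f hab
    rw [map_add, map_smul, map_smul, hfu, hfv, map_zero] at h1
    have h2 : (a * ((s 0 : ℂ) - s 1)) • u = 0 := by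
      have h3 : (a * ((s 0 : ℂ) - s 1)) • u = (a • (s 0 : ℂ) • u + b • (s 1 : ℂ) • v) -
          (s 1 : ℂ) • (a • u + b • v) := by module
      rw [h3, h1, hab, smul_zero, sub_zero]
    have ha : a = 0 := by
      have := (smul_eq_zero.mp h2).resolve_right hu
      exact (mul_eq_zero.mp this).resolve_right hsC
    rw [ha, zero_smul, zero_add] at hab
    exact ⟨ha, (smul_eq_zero.mp hab).resolve_right hv⟩
  let β := basisOfLinearIndependentOfCardEqFinrank' _ hli (by simp)
  refine ⟨β, fun k => ?_⟩
  fin_cases k <;> simp [β, hfu, hfv]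

variable {K : Type*} [Field K] [NumberField K] {A : PrincipallyPolarizedAbelianVariety 2}
  {φ : 𝓞 K →+* complexTorusEnd A.lattice}

/-- A ring homomorphism from the ring of integers to the complex numbers is injective. -/
theorem ringOfIntegers_ringHom_injective (f : 𝓞 K →+* ℂ) : Function.Injective f := by
  rw [injective_iff_map_eq_zero]
  have h := Ideal.absNorm_mem (RingHom.ker f)
  rw [RingHom.mem_ker, map_natCast, Nat.cast_eq_zero, Ideal.absNorm_eq_zero_iff] at h
  intro a ha
  have : a ∈ RingHom.ker f := ha
  rwa [h] at this

/-- Everything commuting with an operator with distinct eigenvalues preserves its eigenlines; the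
resulting characters of `𝓞 K` are injective and extend to `K`. -/
theorem exists_embeddings {α : 𝓞 K} {s : Fin 2 → ℝ} (hs : s 0 ≠ s 1)
    {β : Module.Basis (Fin 2) ℂ (Fin 2 → ℂ)}
    (hβ : ∀ k, (φ α : Module.End ℂ (Fin 2 → ℂ)) (β k) = (s k : ℂ) • β k) :
    ∃ σ : Fin 2 → K →+* ℂ, ∀ (a : 𝓞 K) k,
      (φ a : Module.End ℂ (Fin 2 → ℂ)) (β k) = σ k a • β k := by
  have hdiag : ∀ (a : 𝓞 K) k,
      (φ a : Module.End ℂ (Fin 2 → ℂ)) (β k) =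
        β.repr ((φ a : Module.End ℂ (Fin 2 → ℂ)) (β k)) k • β k := by
    intro a k
    have hcomm : (φ α : Module.End ℂ (Fin 2 → ℂ)) ((φ a : Module.End ℂ (Fin 2 → ℂ)) (β k)) =
        (s k : ℂ) • (φ a : Module.End ℂ (Fin 2 → ℂ)) (β k) := by
      rw [← map_smul, ← hβ, ← Module.End.mul_apply, ← Module.End.mul_apply, ← Subring.coe_mul,
        ← Subring.coe_mul, ← map_mul, ← map_mul, mul_comm]
    set y := (φ a : Module.End ℂ (Fin 2 → ℂ)) (β k)
    have hy := β.sum_repr y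
    have hother : ∀ l, l ≠ k → β.repr y l = 0 := by
      intro l hl
      have h1 : β.repr ((φ α : Module.End ℂ (Fin 2 → ℂ)) y) l = s l * β.repr y l := by
        conv_lhs => rw [← hy]
        rw [map_sum, map_sum]
        simp only [map_smul, hβ, Module.Basis.repr_self, Finsupp.coe_finsetSum,
          Finset.sum_apply, Finsupp.smul_apply, smul_eq_mul, Finsupp.single_apply]
        simp [mul_comm]
      rw [hcomm, map_smul, Finsupp.smul_apply, smul_eq_mul] at h1
      have h2 : ((s k : ℂ) - s l) * β.repr y l = 0 := by rw [sub_mul, h1, sub_self]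
      refine (mul_eq_zero.mp h2).resolve_left (sub_ne_zero.mpr ?_)
      have : s k ≠ s l := by
        fin_cases k <;> fin_cases l <;> simp_all [eq_comm]
      exact_mod_cast this
    conv_lhs => rw [← hy]
    exact Finset.sum_eq_single k (fun l _ hl => by rw [hother l hl, zero_smul]) (by simp)
  let τ : Fin 2 → 𝓞 K →+* ℂ := fun k =>
    { toFun := fun a => β.repr ((φ a : Module.End ℂ (Fin 2 → ℂ)) (β k)) k
      map_one' := by simp
      map_zero' := by simp
      map_add' := by intro a b; simp
      map_mul' := by
        intro a b
        rw [map_mul, Subring.coe_mul, Module.End.mul_apply, hdiag b k]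
        simp [mul_comm] }
  refine ⟨fun k => IsFractionRing.lift (ringOfIntegers_ringHom_injective (τ k)), fun a k => ?_⟩
  rw [IsFractionRing.lift_algebraMap]
  exact hdiag a k

/-- Let `C` be the mixed part of `E` between the two eigenlines. The combination `F`, formed from
`E` by the polynomial of `T²`, is integral on `Λ` and kills the unmixed part, so `F = κC`. Since `T`
multiplies `C` by `h₀h₁`, a nonzero value of `C` on `Λ` would make `h₀h₁` a ratio of integers,
against `mul_ne_ratCast`. -/
theorem form_eigenvectors_eq_zero (hK : IsPrimitiveQuarticCMField K) {T : 𝓞 K} {t n : ℤ}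
    (hT : (T : K) ^ 4 - t * (T : K) ^ 2 + n = 0) {σ : Fin 2 → K →+* ℂ} {h : Fin 2 → ℝ}
    (hσ : ∀ k, σ k T = Complex.I * h k) (hne : h 0 ^ 2 ≠ h 1 ^ 2) (h0 : ∀ k, h k ≠ 0)
    {β : Module.Basis (Fin 2) ℂ (Fin 2 → ℂ)}
    (hβ : ∀ k, (φ T : Module.End ℂ (Fin 2 → ℂ)) (β k) = (Complex.I * h k) • β k) (a b : ℂ) :
    A.form (a • β 0) (b • β 1) = 0 := by
  have hd := A.discrete
  have hz := A.isZLattice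
  obtain ⟨ht, hn⟩ := IsPrimitiveQuarticCMField.trace_eq_and_norm_eq hT hσ hne
  let f : Module.End ℂ (Fin 2 → ℂ) := (φ T).1
  have hf : ∀ x ∈ A.lattice, f x ∈ A.lattice := fun x hx => (φ T).2 x hx
  -- The value of `h_k²h_l² + t h_k h_l + n` for `k ≠ l`; for `k = l` it is zero.
  let κ : ℝ := -(h 0 * h 1 * (h 0 - h 1) ^ 2)
  have hκ : κ ≠ 0 := by
    have : h 0 - h 1 ≠ 0 := fun h' => hne (by rw [sub_eq_zero.mp h'])
    exact neg_ne_zero.mpr (mul_ne_zero (mul_ne_zero (h0 0) (h0 1)) (pow_ne_zero 2 this))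
  let π : Fin 2 → (Fin 2 → ℂ) →ₗ[ℝ] (Fin 2 → ℂ) := fun k =>
    ((LinearMap.toSpanSingleton ℂ _ (β k)).comp (β.coord k)).restrictScalars ℝ
  let C : LinearMap.BilinForm ℝ (Fin 2 → ℂ) :=
    A.form.compl₁₂ (π 0) (π 1) + A.form.compl₁₂ (π 1) (π 0)
  have hC : ∀ x y, C x y = A.form (β.repr x 0 • β 0) (β.repr y 1 • β 1) +
      A.form (β.repr x 1 • β 1) (β.repr y 0 • β 0) := fun x y => rfl
  let F : (Fin 2 → ℂ) → (Fin 2 → ℂ) → ℝ := fun x y =>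
    A.form (f (f x)) (f (f y)) + t * A.form (f x) (f y) + n * A.form x y
  have hrepr : ∀ x k, β.repr (f x) k = Complex.I * h k * β.repr x k := by
    intro x k
    have hfx : f x = ∑ l, β.repr x l • (Complex.I * h l) • β l := by
      conv_lhs => rw [← β.sum_repr x]
      rw [map_sum]
      exact Finset.sum_congr rfl fun l _ => by rw [map_smul]; exact congrArg _ (hβ l)
    rw [hfx]
    fin_cases k <;> simp [Fin.sum_univ_two, mul_comm]
  let G : Fin 2 → Fin 2 → (Fin 2 → ℂ) → (Fin 2 → ℂ) → ℝ := fun k l x y =>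
    A.form (β.repr x k • β k) (β.repr y l • β l)
  have hG : ∀ k l x y, G k l (f x) (f y) = h k * h l * G k l x y := by
    intro k l x y
    simp only [G, hrepr, mul_smul _ (β.repr _ _), form_imaginary_smul]
  have hsum : ∀ x y, A.form x y = G 0 0 x y + G 0 1 x y + (G 1 0 x y + G 1 1 x y) := by
    intro x y
    conv_lhs => rw [← β.sum_repr x, ← β.sum_repr y]
    simp only [G, Fin.sum_univ_two, map_add, LinearMap.add_apply]
    ring
  replace hC : ∀ x y, C x y = G 0 1 x y + G 1 0 x y := hC
  have hF : ∀ x y, F x y = κ * C x y := by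
    intro x y
    simp only [F, hsum, hG, hC, ht, hn, κ]
    ring
  have hC0 : C = 0 := by
    refine (A.exists_basis_det_eq_one).elim fun b _ => ?_
    refine LinearMap.ext_basis (b.ofZLatticeBasis ℝ A.lattice) (b.ofZLatticeBasis ℝ A.lattice)
      fun i j => ?_
    rw [LinearMap.zero_apply, LinearMap.zero_apply, b.ofZLatticeBasis_apply ℝ A.lattice,
      b.ofZLatticeBasis_apply ℝ A.lattice]
    have hFint : ∀ x ∈ A.lattice, ∀ y ∈ A.lattice, ∃ m : ℤ, F x y = m := by
      intro x hx y hy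
      obtain ⟨m1, hm1⟩ := A.form_integral _ (hf _ (hf _ hx)) _ (hf _ (hf _ hy))
      obtain ⟨m2, hm2⟩ := A.form_integral _ (hf _ hx) _ (hf _ hy)
      obtain ⟨m3, hm3⟩ := A.form_integral _ hx _ hy
      exact ⟨m1 + t * m2 + n * m3, by simp only [F, hm1, hm2, hm3]; push_cast; ring⟩
    obtain ⟨m1, hm1⟩ := hFint _ (b i).2 _ (b j).2
    obtain ⟨m2, hm2⟩ := hFint _ (hf _ (b i).2) _ (hf _ (b j).2)
    have hCf : C (f (b i)) (f (b j)) = h 0 * h 1 * C (b i) (b j) := by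
      rw [hC, hC, hG, hG]
      ring
    rw [hF, hCf] at hm2
    rw [hF] at hm1
    by_contra hne0
    have hm10 : (m1 : ℝ) ≠ 0 := hm1 ▸ mul_ne_zero hκ hne0
    apply hK.mul_ne_ratCast hT hσ hne (h0 0) (m2 / m1)
    push_cast
    rw [eq_div_iff hm10, ← hm1, ← hm2]
    ring
  have h1 := hC (a • β 0) (b • β 1)
  rw [hC0] at h1
  simpa [G] using h1.symm

end PrincipallyPolarizedAbelianVariety

namespace PrincipallyPolarizedAbelianVariety

variable {K : Type*} [Field K] [NumberField K] {A : PrincipallyPolarizedAbelianVariety 2}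
  {φ : 𝓞 K →+* complexTorusEnd A.lattice}

theorem nonempty_cmCoordinates (hK : IsPrimitiveQuarticCMField K) (hφ : Function.Injective φ) :
    Nonempty (CMCoordinates A φ) := by
  obtain ⟨T, t, n, hT, hq, him⟩ := hK.exists_imaginary_integer
  obtain ⟨τ⟩ : Nonempty (K →+* ℂ) := inferInstance
  obtain ⟨r, -, hτ⟩ := him τ
  -- The conjugates of `T²`: one is read off from `τ`, the other is determined by the trace `t`.
  let s : Fin 2 → ℝ := ![-r ^ 2, t + r ^ 2]
  have hτ2 : τ ((T : K) ^ 2) = (-r ^ 2 : ℝ) := by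
    rw [map_pow, hτ, mul_pow, Complex.I_sq]
    push_cast
    ring
  have hs : s 0 ≠ s 1 := by
    intro h
    have h1 : -r ^ 2 = t + r ^ 2 := h
    refine hq (t / 2) (τ.injective ?_)
    rw [hτ2, map_ratCast]
    have : -r ^ 2 = ((t / 2 : ℚ) : ℝ) := by push_cast; linarith
    exact_mod_cast this
  have hn : (n : ℝ) = s 0 * s 1 := by
    have h1 := congrArg τ hT
    rw [map_add, map_sub, map_mul, map_intCast, map_intCast, map_zero,
      show (T : K) ^ 4 = ((T : K) ^ 2) ^ 2 by ring, map_pow τ ((T : K) ^ 2), hτ2] at h1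
    have h2 : (-r ^ 2) ^ 2 - t * (-r ^ 2) + n = 0 := by exact_mod_cast h1
    change (n : ℝ) = -r ^ 2 * (t + r ^ 2)
    linarith
  have ht : (t : ℝ) = s 0 + s 1 := by
    change (t : ℝ) = -r ^ 2 + (t + r ^ 2)
    ring
  have hα : ∀ q : ℚ, ((T ^ 2 : 𝓞 K) : K) ≠ q := fun q h => hq q (by simpa using h)
  have heq : (T ^ 2) ^ 2 - t * T ^ 2 + n = 0 := by
    apply RingOfIntegers.ext
    simp only [map_add, map_sub, map_mul, map_pow, map_intCast, map_zero]
    linear_combination hT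
  obtain ⟨β, hβ⟩ := exists_eigenbasis hφ hα hs ht hn heq
  obtain ⟨σ, hσ⟩ := exists_embeddings hs hβ
  choose h h0 hσT using fun k => him (σ k)
  have hsk : ∀ k, s k = -h k ^ 2 := by
    intro k
    have h1 := hσ (T ^ 2) k
    rw [hβ] at h1
    have h2 := smul_left_injective ℂ (β.ne_zero k) h1
    simp only [map_pow, hσT, mul_pow, Complex.I_sq] at h2
    have h3 : s k = -1 * h k ^ 2 := by exact_mod_cast h2
    linarith
  have hne : h 0 ^ 2 ≠ h 1 ^ 2 := by
    intro h'
    rw [hsk, hsk, h'] at hs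
    exact hs rfl
  have hβT : ∀ k, (φ T : Module.End ℂ (Fin 2 → ℂ)) (β k) = (Complex.I * h k) • β k := by
    intro k
    rw [hσ, hσT]
  have horth := form_eigenvectors_eq_zero hK hT hσT hne h0 hβT
  let γ : Fin 2 → ℝ := fun k => A.form (Complex.I • β k) (β k)
  have hγ : ∀ k, 0 < γ k := fun k => A.form_pos _ (β.ne_zero k)
  have hγ' : ∀ k, ((√(γ k) : ℝ) : ℂ) ≠ 0 := fun k => by
    exact_mod_cast (Real.sqrt_pos.mpr (hγ k)).ne'
  have hmem : (T : K) ^ 2 ∈ maximalRealSubfield K := by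
    rw [mem_maximalRealSubfield_iff]
    intro ψ
    obtain ⟨r, -, hr⟩ := him ψ
    rw [map_pow, hr, mul_pow, Complex.I_sq]
    simp
  -- Scaling by `√γ_k` normalizes `E(iu, u)` to `|·|²` on each eigenline.
  let coord : (Fin 2 → ℂ) ≃ₗ[ℂ] (Fin 2 → ℂ) := β.equivFun.trans
    (LinearEquiv.piCongrRight fun k => LinearEquiv.smulOfNeZero ℂ ℂ _ (hγ' k))
  have hcoord : ∀ x k, coord x k = √(γ k) * β.repr x k := fun x k => rfl
  refine ⟨⟨coord, σ, ⟨⟨_, hmem⟩, ?_⟩, ?_, ?_⟩⟩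
  · intro h'
    simp only [map_pow, hσT, mul_pow, Complex.I_sq] at h'
    have h1 : -1 * h 0 ^ 2 = -1 * h 1 ^ 2 := by exact_mod_cast h'
    exact hne (by linarith)
  · intro a x k
    rw [hcoord, hcoord]
    have hax : (φ a : Module.End ℂ (Fin 2 → ℂ)) x = ∑ l, β.repr x l • σ l a • β l := by
      conv_lhs => rw [← β.sum_repr x]
      rw [map_sum]
      exact Finset.sum_congr rfl fun l _ => by rw [map_smul, hσ]
    rw [hax]
    fin_cases k <;> simp [Fin.sum_univ_two] <;> ring
  · intro x y
    have h10 : A.form (β.repr x 1 • β 1) (β.repr y 0 • β 0) = 0 := by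
      rw [A.form_neg_swap, horth, neg_zero]
    have hγsq : ∀ k, (√(γ k)) * √(γ k) = γ k := fun k => Real.mul_self_sqrt (hγ k).le
    have hk : ∀ k, (coord x k * (starRingEnd ℂ) (coord y k)).im =
        A.form (β.repr x k • β k) (β.repr y k • β k) := by
      intro k
      rw [hcoord, hcoord, form_smul_smul, map_mul, Complex.conj_ofReal,
        show (√(γ k) : ℂ) * β.repr x k * (√(γ k) * (starRingEnd ℂ) (β.repr y k)) =
          ((√(γ k) * √(γ k) : ℝ) : ℂ) * (β.repr x k * (starRingEnd ℂ) (β.repr y k)) by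
          push_cast; ring, hγsq, Complex.im_ofReal_mul, mul_comm]
    conv_lhs => rw [← β.sum_repr x, ← β.sum_repr y]
    simp only [Fin.sum_univ_two, map_add, LinearMap.add_apply, horth, h10, hk, add_zero, zero_add]

end PrincipallyPolarizedAbelianVariety

/-! ### Embeddings of `K` and covolumes of ideal orbits -/

namespace CMCoordinates

variable {K : Type*} [Field K] [NumberField K] {A : PrincipallyPolarizedAbelianVariety 2}
  {φ : 𝓞 K →+* complexTorusEnd A.lattice} (c : CMCoordinates A φ)

theorem form_I_self (x : Fin 2 → ℂ) :
    A.form (Complex.I • x) x = ‖c.coord x 0‖ ^ 2 + ‖c.coord x 1‖ ^ 2 := by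
  rw [c.form_eq]
  simp only [map_smul, Pi.smul_apply, smul_eq_mul, mul_assoc, Complex.mul_conj,
    Fin.sum_univ_two, Complex.normSq_eq_norm_sq, Complex.I_mul_im, Complex.ofReal_re]

theorem embedding_real (k : Fin 2) (a : maximalRealSubfield K) :
    (starRingEnd ℂ) (c.embedding k a) = c.embedding k a := a.2 _

theorem coord_eq_zero {x : Fin 2 → ℂ} (h : c.coord x = 0) : x = 0 :=
  (map_eq_zero_iff _ c.coord.injective).mp h

/-- The two embeddings of the CM type and their conjugates. -/
noncomputable def allEmbeddings : Fin 4 → (K →ₐ[ℚ] ℂ) := fun i =>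
  RingHom.toRatAlgHom (![c.embedding 0, (starRingEnd ℂ).comp (c.embedding 0),
    c.embedding 1, (starRingEnd ℂ).comp (c.embedding 1)] i)

theorem embedding_ne_conj (hK : IsPrimitiveQuarticCMField K) (k : Fin 2) :
    ∃ x : K, c.embedding k x ≠ (starRingEnd ℂ) (c.embedding k x) := by
  obtain ⟨T, t, n, hT, hq, him⟩ := hK.exists_imaginary_integer
  obtain ⟨h, h0, hh⟩ := him (c.embedding k)
  refine ⟨T, ?_⟩
  rw [hh, map_mul, Complex.conj_I, Complex.conj_ofReal]
  intro h'
  have := congrArg Complex.im h'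
  simp at this
  exact h0 (by linarith)

theorem allEmbeddings_bijective (hK : IsPrimitiveQuarticCMField K) :
    Function.Bijective c.allEmbeddings := by
  rw [Fintype.bijective_iff_injective_and_card]
  constructor
  · obtain ⟨a, ha⟩ := c.embedding_ne
    have h0 := c.embedding_real 0 a
    have h1 := c.embedding_real 1 a
    obtain ⟨x, hx⟩ := c.embedding_ne_conj hK 0
    obtain ⟨y, hy⟩ := c.embedding_ne_conj hK 1
    intro i j hij
    have hv := fun z : K => DFunLike.congr_fun hij z
    have hva := hv a
    have hvx := hv x
    have hvy := hv y
    fin_cases i <;> fin_cases j <;> first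
      | rfl
      | exact absurd hva ha
      | exact absurd hva.symm ha
      | exact absurd hvx hx
      | exact absurd hvx.symm hx
      | exact absurd hvy hy
      | exact absurd hvy.symm hy
      | exact absurd (hva.trans h1) ha
      | exact absurd (hva.symm.trans h1) ha
      | exact absurd (h0.symm.trans hva) ha
      | exact absurd (h0.symm.trans hva.symm) ha
      | exact absurd (h0.symm.trans (hva.trans h1)) ha
      | exact absurd (h0.symm.trans (hva.symm.trans h1)) ha
  · rw [AlgHom.card, hK.2.1, Fintype.card_fin]

end CMCoordinates

theorem NumberField.exists_basis_ideal {L : Type*} [Field L] [NumberField L] {d : ℕ}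
    (hd : Module.finrank ℚ L = d) {I : Ideal (𝓞 L)} (hI : I ≠ ⊥) :
    Nonempty (Module.Basis (Fin d) ℤ I) := by
  have h : Module.finrank ℤ I = d := by
    rw [← hd, ← RingOfIntegers.rank L]
    exact Ideal.finrank_eq_finrank (RingOfIntegers.basis L) I hI
  exact ⟨Module.finBasisOfFinrankEq ℤ I h⟩

namespace PrincipallyPolarizedAbelianVariety

/-- The Gram determinant of integral vectors is the square of an integer. -/
theorem exists_det_form_eq_sq (A : PrincipallyPolarizedAbelianVariety 2) (x : Fin 4 → A.lattice) :
    ∃ m : ℤ, (Matrix.of fun i j => A.form (x i) (x j)).det = (m : ℝ) ^ 2 ∧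
      (m = 0 → ¬ LinearIndependent ℤ x) ∧
      (IsUnit m → LinearIndependent ℤ x ∧ Submodule.span ℤ (Set.range x) = ⊤) := by
  obtain ⟨b, hb⟩ := A.exists_basis_det_eq_one
  have hG : (Matrix.of fun i j => A.form (x i) (x j)) =
      ((b.toMatrix x).map (Int.cast : ℤ → ℝ)).transpose *
        (Matrix.of fun i j => A.form (b i) (b j)) * (b.toMatrix x).map (Int.cast : ℤ → ℝ) := by
    have hx : ∀ i, (x i : Fin 2 → ℂ) = ∑ k, (b.toMatrix x k i : ℝ) • (b k : Fin 2 → ℂ) := by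
      intro i
      have h := congrArg (Submodule.subtype A.lattice) (b.sum_repr (x i))
      rw [map_sum] at h
      rw [Submodule.subtype_apply] at h
      rw [← h]
      exact Finset.sum_congr rfl fun k _ => by
        rw [Int.cast_smul_eq_zsmul, map_zsmul]; rfl
    ext i j
    rw [Matrix.of_apply, hx i, hx j]
    simp only [map_sum, LinearMap.sum_apply, map_smul, LinearMap.smul_apply, smul_eq_mul,
      Matrix.mul_apply, Matrix.transpose_apply, Matrix.map_apply, Matrix.of_apply,
      Finset.sum_mul]
    refine Finset.sum_congr rfl fun k _ => ?_
    rw [Finset.mul_sum]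
    exact Finset.sum_congr rfl fun l _ => by ring
  refine ⟨(b.toMatrix x).det, ?_, ?_, fun h => ?_⟩
  · rw [hG, Matrix.det_mul, Matrix.det_mul, hb, Matrix.det_transpose, mul_one, sq]
    have : ((b.toMatrix x).map (Int.cast : ℤ → ℝ)).det = ((b.toMatrix x).det : ℝ) :=
      ((Int.castRingHom ℝ).map_det _).symm
    rw [this]
  · intro h hli
    obtain ⟨v, hv, hv0⟩ := Matrix.exists_mulVec_eq_zero_iff.mpr h
    apply hv
    refine funext (Fintype.linearIndependent_iff.mp hli v ?_)
    apply b.repr.injective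
    ext k
    have := congrFun hv0 k
    simp only [Matrix.mulVec, dotProduct, Module.Basis.toMatrix_apply, Pi.zero_apply] at this
    simp only [map_sum, map_smul, Finsupp.coe_finsetSum, Finset.sum_apply, Finsupp.smul_apply,
      smul_eq_mul, map_zero, Finsupp.zero_apply]
    rw [← this]
    exact Finset.sum_congr rfl fun i _ => mul_comm _ _
  · rwa [Module.Basis.is_basis_iff_det b, Module.Basis.det_apply]

end PrincipallyPolarizedAbelianVariety

theorem Complex.im_mul_conj_eq (z w : ℂ) :
    ((z * (starRingEnd ℂ) w).im : ℂ) =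
      (2 * Complex.I)⁻¹ * (z * (starRingEnd ℂ) w - (starRingEnd ℂ) z * w) := by
  rw [eq_inv_mul_iff_mul_eq₀ (by simp)]
  apply Complex.ext <;> (simp; try ring)

namespace CMCoordinates

variable {K : Type*} [Field K] [NumberField K] {A : PrincipallyPolarizedAbelianVariety 2}
  {φ : 𝓞 K →+* complexTorusEnd A.lattice} (c : CMCoordinates A φ)

/-- Since `Im(z w̄) = (z w̄ - z̄ w)/(2i)`, the Gram matrix factors as `V D Vᵗ` with `V` the matrix
of all four embeddings and `D` made of two alternating `2 × 2` blocks with entries `±|w_k|²/(2i)`.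
-/
theorem det_form_eq {μ : Fin 4 → K} {w : Fin 2 → ℂ} {x : Fin 4 → Fin 2 → ℂ}
    (hx : ∀ i k, c.coord (x i) k = c.embedding k (μ i) * w k) :
    ((Matrix.of fun i j => A.form (x i) (x j)).det : ℂ) =
      (Matrix.of fun i j => c.allEmbeddings j (μ i)).det ^ 2 *
        ((‖w 0‖ : ℂ) * ‖w 1‖) ^ 4 / 16 := by
  let p : Fin 2 → ℂ := fun k => (2 * Complex.I)⁻¹ * (‖w k‖ : ℂ) ^ 2
  let D : Matrix (Fin 4) (Fin 4) ℂ :=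
    !![0, p 0, 0, 0; -p 0, 0, 0, 0; 0, 0, 0, p 1; 0, 0, -p 1, 0]
  have hD : D.det = (p 0 * p 1) ^ 2 := by
    simp [D, Matrix.det_succ_row_zero, Fin.sum_univ_succ, Fin.succAbove]
    ring
  have hp : (p 0 * p 1) ^ 2 = ((‖w 0‖ : ℂ) * ‖w 1‖) ^ 4 / 16 := by
    simp only [p, mul_inv, Complex.inv_I]
    ring_nf
    simp [Complex.I_pow_four]
  have hG : (Matrix.of fun i j => A.form (x i) (x j)).map (Complex.ofRealHom : ℝ → ℂ) =
      (Matrix.of fun i j => c.allEmbeddings j (μ i)) * D *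
        (Matrix.of fun i j => c.allEmbeddings j (μ i)).transpose := by
    ext i j
    have hk : ∀ k, ((c.coord (x i) k * (starRingEnd ℂ) (c.coord (x j) k)).im : ℂ) =
        p k * (c.embedding k (μ i) * (starRingEnd ℂ) (c.embedding k (μ j)) -
          (starRingEnd ℂ) (c.embedding k (μ i)) * c.embedding k (μ j)) := by
      intro k
      rw [Complex.im_mul_conj_eq, hx, hx, map_mul, map_mul]
      have h1 : w k * (starRingEnd ℂ) (w k) = (‖w k‖ : ℂ) ^ 2 := Complex.mul_conj' (w k)
      simp only [p, ← h1]
      ring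
    rw [Matrix.map_apply, Matrix.of_apply, c.form_eq, Fin.sum_univ_two]
    simp only [Complex.ofRealHom_eq_coe, Complex.ofReal_add, hk]
    simp [Matrix.mul_apply, Fin.sum_univ_four, D, allEmbeddings]
    ring
  have hdet := congrArg Matrix.det hG
  rw [Matrix.det_mul, Matrix.det_mul, Matrix.det_transpose, hD, hp] at hdet
  have : ((Matrix.of fun i j => A.form (x i) (x j)).det : ℂ) =
      ((Matrix.of fun i j => A.form (x i) (x j)).map (Complex.ofRealHom : ℝ → ℂ)).det :=
    Complex.ofRealHom.map_det _
  rw [this, hdet]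
  ring

/-- The right side dominates the squared index of `M·w` in the unimodular lattice `Λ`, a nonzero
integer because `α ↦ α·w` is injective on `M`. -/
theorem one_le_covolume (hK : IsPrimitiveQuarticCMField K) {M : Ideal (𝓞 K)} (hM : M ≠ ⊥)
    {w : Fin 2 → ℂ} (hw : w ≠ 0)
    (h : ∀ α ∈ M, ∃ x ∈ A.lattice, ∀ k, c.coord x k = c.embedding k α * w k) :
    1 ≤ (Ideal.absNorm M : ℝ) ^ 2 * |(discr K : ℝ)| * (‖w 0‖ * ‖w 1‖) ^ 4 / 16 := by
  obtain ⟨b⟩ := NumberField.exists_basis_ideal hK.2.1 hM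
  choose x hx hxc using fun i => h (b i) (b i).2
  obtain ⟨m, hm, hm0, -⟩ := A.exists_det_form_eq_sq fun i => ⟨x i, hx i⟩
  have hdet := c.det_form_eq hxc
  have hdisc := NumberField.absNorm_sq_mul_discr
    (Equiv.ofBijective _ (c.allEmbeddings_bijective hK)) M
    (Module.finBasisOfFinrankEq ℤ (𝓞 K) ((RingOfIntegers.rank K).trans hK.2.1)) b
  simp only [Equiv.ofBijective_apply] at hdisc
  rw [← hdisc, hm] at hdet
  have hm2 : (m : ℝ) ^ 2 =
      (Ideal.absNorm M : ℝ) ^ 2 * (discr K : ℝ) * (‖w 0‖ * ‖w 1‖) ^ 4 / 16 := by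
    exact_mod_cast hdet
  have hli : LinearIndependent ℤ fun i => (⟨x i, hx i⟩ : A.lattice) := by
    rw [Fintype.linearIndependent_iff]
    intro g hg
    obtain ⟨k, hk⟩ : ∃ k, w k ≠ 0 := by
      by_contra! h
      exact hw (funext h)
    have h1 : ∑ i, g i • x i = 0 := by
      have := congrArg (Submodule.subtype A.lattice) hg
      rw [map_sum, map_zero] at this
      rw [← this]
      exact Finset.sum_congr rfl fun i _ => by rw [map_zsmul]; rfl
    have h2 : c.embedding k (∑ i, g i • ((b i : 𝓞 K) : K)) * w k = 0 := by
      have := congrFun (congrArg c.coord h1) k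
      rw [map_sum, map_zero, Finset.sum_apply] at this
      rw [map_sum, Finset.sum_mul, ← Pi.zero_apply (M := fun _ => ℂ) k, ← this]
      exact Finset.sum_congr rfl fun i _ => by
        rw [map_zsmul, map_zsmul, Pi.smul_apply, hxc, smul_mul_assoc]
    have h3 := (map_eq_zero _).mp ((mul_eq_zero.mp h2).resolve_right hk)
    refine Fintype.linearIndependent_iff.mp b.linearIndependent g ?_
    apply Subtype.ext
    apply RingOfIntegers.ext
    simpa using h3
  have hm1 : (1 : ℝ) ≤ (m : ℝ) ^ 2 := by
    have : m ≠ 0 := fun h => hm0 h hli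
    have : 1 ≤ m ^ 2 := by have := sq_pos_of_ne_zero this; omega
    exact_mod_cast this
  calc (1 : ℝ) ≤ (Ideal.absNorm M : ℝ) ^ 2 * (discr K : ℝ) * (‖w 0‖ * ‖w 1‖) ^ 4 / 16 :=
        hm2 ▸ hm1
    _ ≤ _ := by gcongr; exact le_abs_self _

end CMCoordinates

/-! ### Minkowski's theorem for the sum of the absolute values of two complex coordinates -/

/-- The basis of `ℂ²` over the real numbers consisting of real and imaginary units. -/
noncomputable def complexPlaneBasis : Module.Basis (Fin 4) ℝ (Fin 2 → ℂ) :=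
  ((Pi.basis fun _ : Fin 2 => Complex.basisOneI).reindex (Equiv.sigmaEquivProd _ _)).reindex
    (finProdFinEquiv : Fin 2 × Fin 2 ≃ Fin 4)

theorem complexPlaneBasis_repr (x : Fin 2 → ℂ) (i : Fin 4) :
    complexPlaneBasis.repr x i = ![(x 0).re, (x 0).im, (x 1).re, (x 1).im] i := by
  fin_cases i <;> rfl

open MeasureTheory in
theorem volume_fundamentalDomain_complexPlaneBasis :
    volume (ZSpan.fundamentalDomain complexPlaneBasis) = 1 := by
  have h : ZSpan.fundamentalDomain complexPlaneBasis = Set.univ.pi fun _ : Fin 2 =>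
      Complex.measurableEquivPi ⁻¹' (Set.univ.pi fun _ => Set.Ico (0 : ℝ) 1) := by
    ext x
    simp [ZSpan.mem_fundamentalDomain, complexPlaneBasis_repr, Fin.forall_fin_succ,
      Complex.measurableEquivPi, and_assoc]
  rw [h, volume_pi, Measure.pi_pi, Complex.volume_preserving_equiv_pi.measure_preimage ?_,
    volume_pi, Measure.pi_pi, Real.volume_Ico, sub_zero, ENNReal.ofReal_one,
    Finset.prod_const_one, Finset.prod_const_one]
  exact (MeasurableSet.pi Set.countable_univ (fun _ _ => measurableSet_Ico)).nullMeasurableSet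

/-- The convex body `|x₀| + |x₁| ≤ r` in `ℂ²`. -/
def complexCrossPolytope (r : ℝ) : Set (Fin 2 → ℂ) := {x | ‖x 0‖ + ‖x 1‖ ≤ r}

theorem mem_complexCrossPolytope {r : ℝ} {x : Fin 2 → ℂ} :
    x ∈ complexCrossPolytope r ↔ ‖x 0‖ + ‖x 1‖ ≤ r := Iff.rfl

theorem convex_complexCrossPolytope (r : ℝ) : Convex ℝ (complexCrossPolytope r) := by
  refine Convex_subadditive_le (f := fun x : Fin 2 → ℂ => ‖x 0‖ + ‖x 1‖) (fun x y => ?_)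
    (fun c x h => ?_) r
  · have h0 := norm_add_le (x 0) (y 0)
    have h1 := norm_add_le (x 1) (y 1)
    simp only [Pi.add_apply]
    linarith
  · simp only [Pi.smul_apply, norm_smul, Real.norm_of_nonneg h]
    exact le_of_eq (by ring)

theorem isCompact_complexCrossPolytope (r : ℝ) : IsCompact (complexCrossPolytope r) := by
  rw [Metric.isCompact_iff_isClosed_bounded]
  constructor
  · exact isClosed_le (by fun_prop) continuous_const
  · refine (Metric.isBounded_closedBall (x := (0 : Fin 2 → ℂ)) (r := r)).subset fun x hx => ?_
    rw [mem_complexCrossPolytope] at hx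
    have h0 := norm_nonneg (x 0)
    have h1 := norm_nonneg (x 1)
    rw [mem_closedBall_zero_iff, pi_norm_le_iff_of_nonneg (by linarith)]
    intro i
    fin_cases i <;> simp <;> linarith

open MeasureTheory in
theorem volume_complexCrossPolytope {r : ℝ} (hr : 0 ≤ r) :
    volume (complexCrossPolytope r) = ENNReal.ofReal (r ^ 4 * (Real.pi ^ 2 / 6)) := by
  have h := Complex.volume_sum_rpow_le (Fin 2) (p := 1) le_rfl r
  have h2 : Real.Gamma (2 / 1 + 1) = 2 := by
    rw [show (2 / 1 + 1 : ℝ) = (2 : ℕ) + 1 by norm_num, Real.Gamma_nat_eq_factorial]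
    norm_num [Nat.factorial]
  have h4 : Real.Gamma (2 * Fintype.card (Fin 2) / 1 + 1) = 24 := by
    rw [show (2 * Fintype.card (Fin 2) / 1 + 1 : ℝ) = (4 : ℕ) + 1 by norm_num,
      Real.Gamma_nat_eq_factorial]
    norm_num [Nat.factorial]
  rw [h2, h4] at h
  simp only [Real.rpow_one, Fin.sum_univ_two, div_one, Fintype.card_fin] at h
  rw [complexCrossPolytope, h, ← ENNReal.ofReal_pow hr, ← ENNReal.ofReal_mul (by positivity)]
  congr 1
  ring

open MeasureTheory in
theorem exists_mem_span_norm_mul_norm_le (b : Module.Basis (Fin 4) ℝ (Fin 2 → ℂ))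
    (hb : |complexPlaneBasis.det b| = 1) :
    ∃ x ∈ Submodule.span ℤ (Set.range b), x ≠ 0 ∧ (‖x 0‖ * ‖x 1‖) ^ 2 ≤ 6 / Real.pi ^ 2 := by
  have hF : volume (ZSpan.fundamentalDomain b) = 1 := by
    rw [ZSpan.measure_fundamentalDomain b volume complexPlaneBasis, hb,
      volume_fundamentalDomain_complexPlaneBasis, ENNReal.ofReal_one, mul_one]
  -- Chosen so that the body has volume `2⁴` against covolume one; then `|x₀x₁| ≤ r²/4` by the
  -- inequality of means.
  let r : ℝ := √(√(96 / Real.pi ^ 2))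
  have hr : r ^ 4 = 96 / Real.pi ^ 2 := by
    rw [show r ^ 4 = (r ^ 2) ^ 2 by ring, Real.sq_sqrt (Real.sqrt_nonneg _),
      Real.sq_sqrt (by positivity)]
  have hcount : Countable (Submodule.span ℤ (Set.range b)).toAddSubgroup := by
    change Countable (Submodule.span ℤ (Set.range b))
    infer_instance
  have hdisc : DiscreteTopology (Submodule.span ℤ (Set.range b)).toAddSubgroup := by
    change DiscreteTopology (Submodule.span ℤ (Set.range b))
    infer_instance
  obtain ⟨⟨x, hx⟩, hx0, hxs⟩ := exists_ne_zero_mem_lattice_of_measure_mul_two_pow_le_measure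
    (μ := volume) (s := complexCrossPolytope r) (ZSpan.isAddFundamentalDomain' b volume)
    (fun x hx => by simpa [mem_complexCrossPolytope] using hx) (convex_complexCrossPolytope r)
    (isCompact_complexCrossPolytope r) (by
      rw [hF, volume_complexCrossPolytope (Real.sqrt_nonneg _), hr,
        Module.finrank_eq_card_basis complexPlaneBasis, Fintype.card_fin]
      have : 96 / Real.pi ^ 2 * (Real.pi ^ 2 / 6) = 16 := by field_simp; norm_num
      rw [this]
      norm_num)
  refine ⟨x, hx, fun h => hx0 (Subtype.ext h), ?_⟩
  rw [mem_complexCrossPolytope] at hxs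
  have h0 := norm_nonneg (x 0)
  have h1 := norm_nonneg (x 1)
  have h2 : ‖x 0‖ * ‖x 1‖ ≤ r ^ 2 / 4 := by
    nlinarith [sq_nonneg (‖x 0‖ - ‖x 1‖)]
  calc (‖x 0‖ * ‖x 1‖) ^ 2 ≤ (r ^ 2 / 4) ^ 2 := by gcongr
    _ = 6 / Real.pi ^ 2 := by
      rw [show (r ^ 2 / 4) ^ 2 = r ^ 4 / 16 by ring, hr]
      ring

namespace CMCoordinates

variable {K : Type*} [Field K] [NumberField K] {A : PrincipallyPolarizedAbelianVariety 2}
  {φ : 𝓞 K →+* complexTorusEnd A.lattice} (c : CMCoordinates A φ)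

/-- In these coordinates `E` is the standard symplectic form, so Gram determinant one means that the
image of `Λ` has covolume one. -/
theorem exists_norm_mul_norm_le :
    ∃ x ∈ A.lattice, x ≠ 0 ∧ (‖c.coord x 0‖ * ‖c.coord x 1‖) ^ 2 ≤ 6 / Real.pi ^ 2 := by
  obtain ⟨b, hb⟩ := A.exists_basis_det_eq_one
  have hd := A.discrete
  have hz := A.isZLattice
  let B : Module.Basis (Fin 4) ℝ (Fin 2 → ℂ) :=
    (b.ofZLatticeBasis ℝ A.lattice).map (c.coord.restrictScalars ℝ)
  have hB : ∀ i, B i = c.coord (b i) := fun i => by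
    simp only [B, Module.Basis.map_apply, b.ofZLatticeBasis_apply ℝ A.lattice]
    rfl
  let J : Matrix (Fin 4) (Fin 4) ℝ := !![0, -1, 0, 0; 1, 0, 0, 0; 0, 0, 0, -1; 0, 0, 1, 0]
  have hJ : J.det = 1 := by
    simp [J, Matrix.det_succ_row_zero, Fin.sum_univ_succ, Fin.succAbove]
  have hG : (Matrix.of fun i j => A.form (b i) (b j)) =
      (complexPlaneBasis.toMatrix B).transpose * J * complexPlaneBasis.toMatrix B := by
    ext i j
    rw [Matrix.of_apply, c.form_eq]
    simp only [Matrix.mul_apply, Matrix.transpose_apply, Module.Basis.toMatrix_apply,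
      complexPlaneBasis_repr, hB, Fin.sum_univ_four, Fin.sum_univ_two, J]
    simp
    ring
  have hdet : complexPlaneBasis.det B ^ 2 = 1 := by
    rw [hG, Matrix.det_mul, Matrix.det_mul, hJ, Matrix.det_transpose, mul_one, ← sq] at hb
    exact hb
  obtain ⟨x, hx, hx0, hle⟩ := exists_mem_span_norm_mul_norm_le B
    ((pow_eq_one_iff_of_nonneg (abs_nonneg _) two_ne_zero).mp (by rwa [sq_abs]))
  refine ⟨c.coord.symm x, ?_, by simpa using hx0, by simpa using hle⟩
  clear hx0 hle
  induction hx using Submodule.span_induction with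
  | mem x h =>
    obtain ⟨i, rfl⟩ := h
    rw [hB, LinearEquiv.symm_apply_apply]
    exact (b i).2
  | zero => simp
  | add x y _ _ hx hy => rw [map_add]; exact A.lattice.add_mem hx hy
  | smul a x _ hx => rw [map_zsmul]; exact A.lattice.smul_mem a hx

end CMCoordinates

/-! ### Symplectic bases -/

namespace PrincipallyPolarizedAbelianVariety

/-- Unimodularity: every integral functional is represented by the polarization. -/
theorem exists_form_eq (A : PrincipallyPolarizedAbelianVariety 2) (ℓ : A.lattice →ₗ[ℤ] ℤ) :
    ∃ x : A.lattice, ∀ y : A.lattice, A.form x y = ℓ y := by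
  obtain ⟨b, hb⟩ := A.exists_basis_det_eq_one
  choose G hG using fun i j => A.form_integral _ (b i).2 _ (b j).2
  have hGdet : (Matrix.of G).det = 1 := by
    have h1 : (Matrix.of fun i j => A.form (b i) (b j)) =
        (Int.castRingHom ℝ).mapMatrix (Matrix.of G) := by
      ext i j
      exact hG i j
    rw [h1, ← RingHom.map_det] at hb
    exact Int.cast_injective (α := ℝ) (by simpa using hb)
  let c : Fin 4 → ℤ := Matrix.vecMul (fun j => ℓ (b j)) (Matrix.of G)⁻¹
  have hc : Matrix.vecMul c (Matrix.of G) = fun j => ℓ (b j) := by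
    rw [Matrix.vecMul_vecMul, Matrix.nonsing_inv_mul _ (by rw [hGdet]; exact isUnit_one),
      Matrix.vecMul_one]
  have hcoe : ∀ d : Fin 4 → ℤ, ((∑ i, d i • b i : A.lattice) : Fin 2 → ℂ) =
      ∑ i, (d i : ℝ) • (b i : Fin 2 → ℂ) := by
    intro d
    rw [← Submodule.subtype_apply, map_sum]
    exact Finset.sum_congr rfl fun i _ => by rw [Int.cast_smul_eq_zsmul, map_zsmul]; rfl
  refine ⟨∑ i, c i • b i, fun y => ?_⟩
  have hx : ∀ j, A.form (∑ i, c i • b i : A.lattice) (b j) = ℓ (b j) := by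
    intro j
    rw [hcoe]
    simp only [map_sum, map_smul, LinearMap.sum_apply, LinearMap.smul_apply, hG, smul_eq_mul]
    have := congrArg (Int.cast : ℤ → ℝ) (congrFun hc j)
    rw [← this]
    simp [Matrix.vecMul, dotProduct]
  rw [← b.sum_repr y, map_sum, hcoe (b.repr y)]
  simp only [map_sum, map_smul, hx, smul_eq_mul]
  simp

/-- A saturated isotropic sublattice of rank two is spanned by the second half of a symplectic
basis. -/
theorem exists_isSymplecticBasis (A : PrincipallyPolarizedAbelianVariety 2)
    {L : Submodule ℤ A.lattice} (hiso : ∀ x ∈ L, ∀ y ∈ L, A.form x y = 0)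
    (hsat : ∀ (n : ℤ) (x : A.lattice), n ≠ 0 → n • x ∈ L → x ∈ L)
    (hrank : Module.finrank ℤ L = 2) :
    ∃ (b : Module.Basis (Fin 2 ⊕ Fin 2) ℤ A.lattice) (v : Module.Basis (Fin 2) ℤ L),
      A.IsSymplecticBasis b ∧ ∀ i, b (Sum.inr i) = v i := by
  obtain ⟨b₀, -⟩ := A.exists_basis_det_eq_one
  obtain ⟨n, s⟩ := Submodule.smithNormalForm b₀ L
  obtain rfl : n = 2 := by rw [← hrank, Module.finrank_eq_card_basis s.bN, Fintype.card_fin]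
  have ha : ∀ i, s.a i ≠ 0 := by
    intro i h
    apply s.bN.ne_zero i
    apply Subtype.ext
    rw [s.snf, h, zero_smul]
    rfl
  -- Saturation makes the elementary divisors irrelevant: `L` is spanned by part of a basis of `Λ`,
  -- so its coordinate functionals extend to `Λ` and are represented by `E`.
  have hv : ∀ i, s.bM (s.f i) ∈ L := fun i =>
    hsat (s.a i) _ (ha i) (by rw [← s.snf]; exact (s.bN i).2)
  have hli : LinearIndependent ℤ fun i => (⟨s.bM (s.f i), hv i⟩ : L) :=
    LinearIndependent.of_comp L.subtype (s.bM.linearIndependent.comp s.f s.f.injective)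
  let v : Module.Basis (Fin 2) ℤ L := Module.Basis.mk hli (by
    rw [← s.bN.span_eq, Submodule.span_le]
    rintro _ ⟨i, rfl⟩
    have : s.bN i = s.a i • ⟨s.bM (s.f i), hv i⟩ := Subtype.ext (s.snf i)
    rw [this]
    exact Submodule.smul_mem _ _ (Submodule.subset_span ⟨i, rfl⟩))
  have hvv : ∀ i, (v i : A.lattice) = s.bM (s.f i) := fun i => by simp [v]
  choose e he using fun i => A.exists_form_eq (s.bM.coord (s.f i))
  have hev : ∀ i j, A.form (e i) (v j : A.lattice) = if i = j then 1 else 0 := by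
    intro i j
    rw [hvv, he]
    simp [Finsupp.single_apply, eq_comm]
  have hvl : ∀ i j, A.form (v i : A.lattice) (v j : A.lattice) = 0 := fun i j =>
    hiso _ (v i).2 _ (v j).2
  obtain ⟨m, hm⟩ := A.form_integral _ (e 0).2 _ (e 1).2
  -- The correction by `m v₀` cancels `E(e₀, e₁) = m` and leaves the pairings with `L` unchanged, as
  -- `L` is isotropic.
  let e' : Fin 2 → A.lattice := ![e 0, e 1 - m • (v 0 : A.lattice)]
  have he1 : ((e 1 - m • (v 0 : A.lattice) : A.lattice) : Fin 2 → ℂ) =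
      (e 1 : Fin 2 → ℂ) - (m : ℝ) • ((v 0 : A.lattice) : Fin 2 → ℂ) := by
    rw [Int.cast_smul_eq_zsmul]
    rfl
  have hev' : ∀ i j, A.form (e' i) (v j : A.lattice) = (1 : Matrix (Fin 2) (Fin 2) ℝ) i j := by
    intro i j
    rw [Matrix.one_apply]
    fin_cases i
    · exact hev 0 j
    · change A.form ((e 1 - m • (v 0 : A.lattice) : A.lattice) : Fin 2 → ℂ) _ = _
      rw [he1, map_sub, map_smul, LinearMap.sub_apply, LinearMap.smul_apply, hvl, smul_zero,
        sub_zero]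
      exact hev 1 j
  have h01 : A.form (e' 0) (e' 1) = 0 := by
    change A.form (e 0) ((e 1 - m • (v 0 : A.lattice) : A.lattice) : Fin 2 → ℂ) = 0
    rw [he1, map_sub, map_smul, hm, hev 0 0]
    simp
  have hee' : ∀ i j, A.form (e' i) (e' j) = 0 := by
    intro i j
    fin_cases i <;> fin_cases j
    · exact A.form_alt _
    · exact h01
    · exact (A.form_neg_swap _ _).trans (neg_eq_zero.mpr h01)
    · exact A.form_alt _
  let x : Fin 2 ⊕ Fin 2 → A.lattice := Sum.elim e' fun i => v i
  have hx : (Matrix.of fun i j => A.form (x i) (x j)) = Matrix.fromBlocks 0 1 (-1) 0 := by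
    ext i j
    rcases i with i | i <;> rcases j with j | j
    · exact hee' i j
    · exact hev' i j
    · simp only [Matrix.of_apply, x, Sum.elim_inl, Sum.elim_inr, Matrix.fromBlocks_apply₂₁,
        Matrix.neg_apply]
      rw [A.form_neg_swap, hev', Matrix.one_apply, Matrix.one_apply]
      simp [eq_comm]
    · exact hvl i j
  let ε : Fin 4 ≃ Fin 2 ⊕ Fin 2 := (finSumFinEquiv (m := 2) (n := 2)).symm
  obtain ⟨d, hd, -, hd'⟩ := A.exists_det_form_eq_sq (x ∘ ε)
  have hdet : (Matrix.of fun i j => A.form ((x ∘ ε) i) ((x ∘ ε) j)).det = 1 := by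
    have h1 : (Matrix.of fun i j => A.form ((x ∘ ε) i) ((x ∘ ε) j)) =
        (Matrix.of fun i j => A.form (x i) (x j)).submatrix ε ε := rfl
    have h2 : (Matrix.fromBlocks 0 1 (-1) 0 :
        Matrix (Fin 2 ⊕ Fin 2) (Fin 2 ⊕ Fin 2) ℝ).submatrix ε ε =
        !![0, 0, 1, 0; 0, 0, 0, 1; -1, 0, 0, 0; 0, -1, 0, 0] := by
      ext i j
      fin_cases i <;> fin_cases j <;>
        simp [ε, finSumFinEquiv, Fin.addCases, Matrix.fromBlocks]
    rw [h1, hx, h2]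
    simp [Matrix.det_succ_row_zero, Fin.sum_univ_succ, Fin.succAbove]
  -- Gram determinant one forces the index in `Λ` to be one.
  have hunit : IsUnit d := by
    rw [hdet] at hd
    have : d * d = 1 := by rw [← sq]; exact_mod_cast hd.symm
    exact IsUnit.of_mul_eq_one _ this
  obtain ⟨h1, h2⟩ := hd' hunit
  let b := (Module.Basis.mk h1 h2.ge).reindex ε
  have hbx : ∀ i, b i = x i := fun i => by simp [b]
  refine ⟨b, v, ?_, fun i => hbx _⟩
  rw [IsSymplecticBasis]
  simp only [hbx]
  exact hx

end PrincipallyPolarizedAbelianVariety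

/-! ### Ideals of the real quadratic subfield and saturated orbits -/

namespace CMCoordinates

variable {K : Type*} [Field K] [NumberField K] {A : PrincipallyPolarizedAbelianVariety 2}
  {φ : 𝓞 K →+* complexTorusEnd A.lattice} (c : CMCoordinates A φ)

theorem embedding_algebraMap (k : Fin 2) (a : 𝓞 (maximalRealSubfield K)) :
    c.embedding k (algebraMap (𝓞 (maximalRealSubfield K)) (𝓞 K) a) =
      ((c.embedding k (a : maximalRealSubfield K)).re : ℂ) :=
  (Complex.conj_eq_iff_re.mp (c.embedding_real k a)).symm

/-- The two embeddings of the real quadratic subfield. -/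
noncomputable def realEmbeddings : Fin 2 → (maximalRealSubfield K →ₐ[ℚ] ℂ) := fun k =>
  RingHom.toRatAlgHom ((c.embedding k).comp (algebraMap (maximalRealSubfield K) K))

theorem realEmbeddings_apply (k : Fin 2) (a : maximalRealSubfield K) :
    c.realEmbeddings k a = ((c.embedding k a).re : ℂ) :=
  (Complex.conj_eq_iff_re.mp (c.embedding_real k a)).symm

theorem realEmbeddings_bijective (hK : IsPrimitiveQuarticCMField K) :
    Function.Bijective c.realEmbeddings := by
  rw [Fintype.bijective_iff_injective_and_card]
  constructor
  · obtain ⟨a, ha⟩ := c.embedding_ne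
    intro i j hij
    have h := DFunLike.congr_fun hij a
    fin_cases i <;> fin_cases j <;> first
      | rfl
      | exact absurd h ha
      | exact absurd h.symm ha
  · rw [AlgHom.card, hK.finrank_maximalRealSubfield, Fintype.card_fin]

theorem absNorm_sq_mul_realSubfieldDiscr (hK : IsPrimitiveQuarticCMField K)
    {I : Ideal (𝓞 (maximalRealSubfield K))} (b : Module.Basis (Fin 2) ℤ I) :
    (Ideal.absNorm I : ℝ) ^ 2 * realSubfieldDiscr K =
      ((c.embedding 0 (b 0 : 𝓞 (maximalRealSubfield K))).re *
          (c.embedding 1 (b 1 : 𝓞 (maximalRealSubfield K))).re -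
        (c.embedding 1 (b 0 : 𝓞 (maximalRealSubfield K))).re *
          (c.embedding 0 (b 1 : 𝓞 (maximalRealSubfield K))).re) ^ 2 := by
  have h := NumberField.absNorm_sq_mul_discr
    (Equiv.ofBijective _ (c.realEmbeddings_bijective hK)) I
    (Module.finBasisOfFinrankEq ℤ (𝓞 (maximalRealSubfield K))
      ((RingOfIntegers.rank _).trans hK.finrank_maximalRealSubfield)) b
  simp only [Equiv.ofBijective_apply, Matrix.det_fin_two, Matrix.of_apply,
    realEmbeddings_apply] at h
  rw [realSubfieldDiscr]
  exact_mod_cast h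

theorem absNorm_le_abs_mul (hK : IsPrimitiveQuarticCMField K)
    {I : Ideal (𝓞 (maximalRealSubfield K))} {a : 𝓞 (maximalRealSubfield K)} (ha : a ∈ I)
    (ha0 : a ≠ 0) :
    (Ideal.absNorm I : ℝ) ≤ |(c.embedding 0 (a : maximalRealSubfield K)).re *
      (c.embedding 1 (a : maximalRealSubfield K)).re| := by
  have hnorm : ((Algebra.norm ℤ a : ℤ) : ℝ) = (c.embedding 0 (a : maximalRealSubfield K)).re *
      (c.embedding 1 (a : maximalRealSubfield K)).re := by
    have h := Algebra.norm_eq_prod_embeddings ℚ ℂ (a : maximalRealSubfield K)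
    rw [← Algebra.coe_norm_int, ← (Equiv.ofBijective _ (c.realEmbeddings_bijective hK)).prod_comp,
      Fin.prod_univ_two] at h
    simp only [Equiv.ofBijective_apply, realEmbeddings_apply, eq_ratCast, Rat.cast_intCast] at h
    exact_mod_cast h
  rw [← hnorm]
  have hdvd := Ideal.absNorm_dvd_norm_of_mem ha
  have h0 : Algebra.norm ℤ a ≠ 0 := Algebra.norm_ne_zero_iff.mpr ha0
  have := Int.le_of_dvd (abs_pos.mpr h0) ((dvd_abs _ _).mpr hdvd)
  exact_mod_cast this

/-- A vanishing coordinate would make the covolume zero, contradicting `one_le_covolume`. -/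
theorem coord_ne_zero (hK : IsPrimitiveQuarticCMField K) {M : Ideal (𝓞 K)} (hM : M ≠ ⊥)
    {w : Fin 2 → ℂ} (hw : w ≠ 0)
    (h : ∀ α ∈ M, ∃ x ∈ A.lattice, ∀ k, c.coord x k = c.embedding k α * w k) (k : Fin 2) :
    w k ≠ 0 := by
  intro hk
  have h1 := c.one_le_covolume hK hM hw h
  have h2 : ‖w 0‖ * ‖w 1‖ = 0 := by fin_cases k <;> simp_all
  rw [h2] at h1
  norm_num at h1

theorem coord_ne_zero_of_mem (hK : IsPrimitiveQuarticCMField K) {v : Fin 2 → ℂ}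
    (hv : v ∈ A.lattice) (hv0 : v ≠ 0) (k : Fin 2) : c.coord v k ≠ 0 :=
  c.coord_ne_zero hK (M := ⊤) top_ne_bot (fun h => hv0 (c.coord_eq_zero h))
    (fun α _ => ⟨_, (φ α).2 v hv, c.coord_act α v⟩) k

/-- Reality of the ratio of `x` to `v` in a single coordinate suffices: an element with one real
image is fixed by complex conjugation. -/
theorem mem_real_of_coord {v : Fin 2 → ℂ} {k : Fin 2} (hv : c.coord v k ≠ 0)
    (hK : IsPrimitiveQuarticCMField K) {α : 𝓞 K} {m : ℤ} {x : Fin 2 → ℂ}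
    (hx : m * c.coord x k = c.embedding k α * c.coord v k)
    (hxv : (c.coord x k * (starRingEnd ℂ) (c.coord v k)).im = 0) :
    ∃ a : 𝓞 (maximalRealSubfield K), algebraMap _ (𝓞 K) a = α := by
  have := hK.1
  have him : (c.embedding k α).im = 0 := by
    have h1 : c.embedding k α * ((‖c.coord v k‖ ^ 2 : ℝ) : ℂ) =
        ((m : ℝ) : ℂ) * (c.coord x k * (starRingEnd ℂ) (c.coord v k)) := by
      push_cast
      rw [← Complex.mul_conj', ← mul_assoc, ← mul_assoc, ← hx]
    have h2 := congrArg Complex.im h1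
    rw [Complex.im_mul_ofReal, Complex.im_ofReal_mul, hxv, mul_zero] at h2
    exact (mul_eq_zero.mp h2).resolve_right (by simpa using hv)
  have hfix : IsCMField.complexConj K α = α := by
    apply (c.embedding k).injective
    rw [IsCMField.complexEmbedding_complexConj, Complex.conj_eq_iff_im, him]
  obtain ⟨a, ha⟩ := (IsCMField.RingOfIntegers.complexConj_eq_self_iff K α).mp hfix
  exact ⟨a, RingOfIntegers.ext ha⟩

/-- The orbit of a nonzero lattice vector has finite index. -/
theorem exists_smul_mem_orbit (c : CMCoordinates A φ) (hK : IsPrimitiveQuarticCMField K) 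
    {v : Fin 2 → ℂ} (hv : v ∈ A.lattice) (hv0 : v ≠ 0) :
    ∃ m : ℤ, m ≠ 0 ∧ ∀ x ∈ A.lattice, ∃ α : 𝓞 K,
      m • x = (φ α : Module.End ℂ (Fin 2 → ℂ)) v := by
  obtain ⟨b, -⟩ := A.exists_basis_det_eq_one
  have := Module.Finite.of_basis b
  have := Module.Free.of_basis b
  let f : 𝓞 K →ₗ[ℤ] A.lattice :=
    { toFun := fun α => ⟨(φ α : Module.End ℂ (Fin 2 → ℂ)) v, (φ α).2 v hv⟩
      map_add' := fun α β => Subtype.ext (by simp)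
      map_smul' := fun n α => Subtype.ext (by simp) }
  have hf : Function.Injective f := by
    rw [injective_iff_map_eq_zero]
    intro α hα
    have h1 := c.coord_act α v 0
    have h2 : (φ α : Module.End ℂ (Fin 2 → ℂ)) v = 0 := congrArg Subtype.val hα
    rw [h2, map_zero, Pi.zero_apply, eq_comm] at h1
    have h3 := (mul_eq_zero.mp h1).resolve_right (c.coord_ne_zero_of_mem hK hv hv0 0)
    rw [map_eq_zero] at h3
    exact RingOfIntegers.ext h3
  have hrank : Module.finrank ℤ (LinearMap.range f) = Module.finrank ℤ A.lattice := by
    rw [LinearMap.finrank_range_of_inj hf, RingOfIntegers.rank, hK.2.1,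
      Module.finrank_eq_card_basis b, Fintype.card_fin]
  have hfin : Finite (A.lattice ⧸ LinearMap.range f) :=
    Submodule.finiteQuotientOfFreeOfRankEq _ hrank
  refine ⟨Nat.card (A.lattice ⧸ LinearMap.range f), by exact_mod_cast Nat.card_pos.ne',
    fun x hx => ?_⟩
  have h1 : (Nat.card (A.lattice ⧸ LinearMap.range f) : ℤ) • (⟨x, hx⟩ : A.lattice) ∈
      LinearMap.range f := by
    rw [← Submodule.Quotient.mk_eq_zero, Submodule.Quotient.mk_smul, natCast_zsmul]
    exact card_nsmul_eq_zero'
  obtain ⟨α, hα⟩ := h1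
  exact ⟨α, (congrArg Subtype.val hα).symm⟩

/-- The saturation of the real multiplication orbit of a lattice vector. -/
theorem exists_realMultiplication_sublattice (hK : IsPrimitiveQuarticCMField K) {v : Fin 2 → ℂ}
    (hv : v ∈ A.lattice) (hv0 : v ≠ 0) :
    ∃ (L : Submodule ℤ A.lattice) (I : Ideal (𝓞 (maximalRealSubfield K))) (w : Fin 2 → ℂ)
      (e : I ≃ₗ[ℤ] L),
      I ≠ ⊥ ∧ w ≠ 0 ∧ (∀ (n : ℤ) (x : A.lattice), n ≠ 0 → n • x ∈ L → x ∈ L) ∧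
      (∀ a k, c.coord (e a : A.lattice) k =
        (c.embedding k (a : 𝓞 (maximalRealSubfield K))).re * w k) ∧
      (∃ a ∈ I, a ≠ 0 ∧ ∀ k, c.coord v k = (c.embedding k (a : maximalRealSubfield K)).re * w k) ∧
      (∀ α ∈ I.map (algebraMap (𝓞 (maximalRealSubfield K)) (𝓞 K)),
        ∃ x ∈ A.lattice, ∀ k, c.coord x k = c.embedding k α * w k) := by
  obtain ⟨m, hm, hmα⟩ := c.exists_smul_mem_orbit hK hv hv0
  have hmC : (m : ℂ) ≠ 0 := by exact_mod_cast hm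
  -- Dividing `v` by `m`, where `mΛ ⊆ 𝓞 K · v`, makes all of `Λ` lie in `𝓞 K · w`.
  let w : Fin 2 → ℂ := fun k => c.coord v k / m
  have hvk := c.coord_ne_zero_of_mem hK hv hv0
  have hmw : ∀ k, m * w k = c.coord v k := fun k => mul_div_cancel₀ _ hmC
  -- The lattice vectors that are real multiples of `v` in each coordinate; this condition is
  -- visibly saturated.
  let L : Submodule ℤ A.lattice :=
    { carrier := {x | ∀ k, (c.coord x k * (starRingEnd ℂ) (c.coord v k)).im = 0}
      add_mem' := fun {x y} hx hy k => by
        have hx' := hx k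
        have hy' := hy k
        rw [Submodule.coe_add, map_add, Pi.add_apply, add_mul, Complex.add_im, hx', hy', add_zero]
      zero_mem' := fun k => by simp
      smul_mem' := fun n x hx k => by
        have hx' := hx k
        rw [Submodule.coe_smul, map_zsmul, Pi.smul_apply, smul_mul_assoc, Complex.smul_im, hx',
          smul_zero] }
  let J : Ideal (𝓞 K) :=
    { carrier := {α | ∃ x ∈ A.lattice, ∀ k, c.coord x k = c.embedding k α * w k}
      add_mem' := by
        rintro α β ⟨x, hx, hxα⟩ ⟨y, hy, hyβ⟩
        refine ⟨x + y, A.lattice.add_mem hx hy, fun k => ?_⟩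
        rw [map_add, Pi.add_apply, hxα, hyβ, ← add_mul, ← map_add]
        rfl
      zero_mem' := ⟨0, A.lattice.zero_mem, fun k => by simp⟩
      smul_mem' := by
        rintro α β ⟨x, hx, hxβ⟩
        refine ⟨_, (φ α).2 x hx, fun k => ?_⟩
        rw [c.coord_act, hxβ, smul_eq_mul, ← mul_assoc, ← map_mul]
        rfl }
  let I : Ideal (𝓞 (maximalRealSubfield K)) := J.comap (algebraMap _ _)
  have hI : ∀ a, a ∈ I ↔ ∃ x ∈ A.lattice, ∀ k, c.coord x k =
      (c.embedding k (a : maximalRealSubfield K)).re * w k := by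
    intro a
    simp only [← embedding_algebraMap]
    rfl
  have hmem : ∀ a : I, ∃ x : L, ∀ k, c.coord (x : A.lattice) k =
      (c.embedding k (a : 𝓞 (maximalRealSubfield K))).re * w k := by
    rintro ⟨a, ha⟩
    obtain ⟨x, hx, hxa⟩ := (hI a).mp ha
    refine ⟨⟨⟨x, hx⟩, fun k => ?_⟩, hxa⟩
    have h1 : c.coord x k * (starRingEnd ℂ) (c.coord v k) =
        (((c.embedding k (a : maximalRealSubfield K)).re * m * ‖w k‖ ^ 2 : ℝ) : ℂ) := by
      rw [hxa, ← hmw, map_mul, map_intCast]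
      push_cast
      rw [← Complex.mul_conj']
      ring
    change (c.coord x k * (starRingEnd ℂ) (c.coord v k)).im = 0
    rw [h1, Complex.ofReal_im]
  choose g hg using hmem
  have hext : ∀ x y : L, (∀ k, c.coord (x : A.lattice) k = c.coord (y : A.lattice) k) → x = y :=
    fun x y h => Subtype.ext (Subtype.ext (c.coord.injective (funext h)))
  have hw0 : ∀ k, w k ≠ 0 := fun k => div_ne_zero (hvk k) hmC
  let e₀ : I →ₗ[ℤ] L :=
    { toFun := g
      map_add' := fun a b => hext _ _ fun k => by
        rw [Submodule.coe_add, Submodule.coe_add, map_add, Pi.add_apply, hg, hg, hg]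
        simp [add_mul]
      map_smul' := fun n a => hext _ _ fun k => by
        simp only [Submodule.coe_smul, map_zsmul, Pi.smul_apply, hg]
        simp
        exact mul_assoc _ _ _ }
  have he₀ : Function.Bijective e₀ := by
    constructor
    · rw [injective_iff_map_eq_zero]
      intro a ha
      have h1 := hg a 0
      have h2 : g a = 0 := ha
      rw [h2] at h1
      have h3 : (c.embedding 0 (a : 𝓞 (maximalRealSubfield K)) : ℂ) = 0 := by
        have := (mul_eq_zero.mp (h1.symm.trans (by simp))).resolve_right (hw0 0)
        rwa [← c.realEmbeddings_apply] at this
      rw [map_eq_zero] at h3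
      exact Subtype.ext (RingOfIntegers.ext (Subtype.ext h3))
    · intro x
      obtain ⟨α, hα⟩ := hmα x (x : A.lattice).2
      have hxk : ∀ k, m * c.coord (x : A.lattice) k = c.embedding k α * c.coord v k := by
        intro k
        rw [← c.coord_act, ← hα, map_zsmul, Pi.smul_apply, zsmul_eq_mul]
      -- Surjectivity: `m x = α v` with `α` real means `x = α w`.
      obtain ⟨a, rfl⟩ := c.mem_real_of_coord (hvk 0) hK (hxk 0) (x.2 0)
      have hxa : ∀ k, c.coord (x : A.lattice) k =
          (c.embedding k (a : maximalRealSubfield K)).re * w k := by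
        intro k
        apply mul_left_cancel₀ hmC
        rw [hxk, ← hmw, embedding_algebraMap]
        ring
      refine ⟨⟨a, (hI a).mpr ⟨x, (x : A.lattice).2, hxa⟩⟩, hext _ _ fun k => ?_⟩
      exact (hg _ k).trans (hxa k).symm
  -- As `m w = v`, the integer `m` lies in `I`, and it serves as the multiplier that recovers `v`.
  have hmI : ((m : 𝓞 (maximalRealSubfield K))) ∈ I :=
    (hI _).mpr ⟨v, hv, fun k => by rw [← hmw]; simp⟩
  have hm0 : ((m : 𝓞 (maximalRealSubfield K))) ≠ 0 := by exact_mod_cast hm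
  refine ⟨L, I, w, LinearEquiv.ofBijective e₀ he₀, ?_, fun h => hw0 0 (congrFun h 0), ?_, hg,
    ⟨m, hmI, hm0, fun k => by rw [← hmw]; simp⟩, fun α hα => ?_⟩
  · intro h
    rw [h] at hmI
    exact hm0 hmI
  · intro n x hn hx k
    have h1 := hx k
    rw [Submodule.coe_smul, map_zsmul, Pi.smul_apply, smul_mul_assoc, Complex.smul_im,
      smul_eq_zero] at h1
    exact h1.resolve_left hn
  · exact Ideal.map_comap_le hα

end CMCoordinates

namespace IsPrimitiveQuarticCMField

variable {K : Type*} [Field K] [NumberField K]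

theorem relDiscrNorm_pos (hK : IsPrimitiveQuarticCMField K) : 0 < relDiscrNorm K := by
  have h := hK.abs_discr_eq
  have h0 := abs_pos.mpr (discr_ne_zero K)
  rw [h] at h0
  rcases Nat.eq_zero_or_pos (relDiscrNorm K) with h1 | h1
  · simp [h1] at h0
  · exact h1

/-- The coordinates present `Δ₀` as the square of a real determinant, so it is nonnegative and the
general bound on `|Δ₀|` applies. -/
theorem two_lt_realSubfieldDiscr (hK : IsPrimitiveQuarticCMField K)
    {A : PrincipallyPolarizedAbelianVariety 2} {φ : 𝓞 K →+* complexTorusEnd A.lattice}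
    (c : CMCoordinates A φ) : 2 < realSubfieldDiscr K := by
  obtain ⟨b⟩ := NumberField.exists_basis_ideal hK.finrank_maximalRealSubfield
    (I := (⊤ : Ideal (𝓞 (maximalRealSubfield K)))) top_ne_bot
  have h := c.absNorm_sq_mul_realSubfieldDiscr hK b
  rw [Ideal.absNorm_top, Nat.cast_one, one_pow, one_mul] at h
  have h0 : (0 : ℝ) ≤ realSubfieldDiscr K := h ▸ sq_nonneg _
  have h1 : 0 ≤ realSubfieldDiscr K := by exact_mod_cast h0
  have h2 := abs_discr_gt_two (K := maximalRealSubfield K)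
    (by rw [hK.finrank_maximalRealSubfield]; norm_num)
  rwa [← realSubfieldDiscr, abs_of_nonneg h1] at h2

end IsPrimitiveQuarticCMField

/-! ### Estimates for period matrices -/

namespace CMCoordinates

variable {K : Type*} [Field K] [NumberField K] {A : PrincipallyPolarizedAbelianVariety 2}
  {φ : 𝓞 K →+* complexTorusEnd A.lattice} (c : CMCoordinates A φ)

theorem two_mul_norm_mul_norm_le (x : Fin 2 → ℂ) :
    2 * (‖c.coord x 0‖ * ‖c.coord x 1‖) ≤ A.form (Complex.I • x) x := by
  rw [c.form_I_self]
  nlinarith [sq_nonneg (‖c.coord x 0‖ - ‖c.coord x 1‖)]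

theorem one_le_covolume_of_mem (hK : IsPrimitiveQuarticCMField K) {x : Fin 2 → ℂ}
    (hx : x ∈ A.lattice) (hx0 : x ≠ 0) :
    16 ≤ (realSubfieldDiscr K : ℝ) ^ 2 * relDiscrNorm K *
      (‖c.coord x 0‖ * ‖c.coord x 1‖) ^ 4 := by
  have h := c.one_le_covolume hK (M := ⊤) top_ne_bot (fun h => hx0 (c.coord_eq_zero h))
    (fun α _ => ⟨_, (φ α).2 x hx, c.coord_act α x⟩)
  have hd : |(discr K : ℝ)| = (realSubfieldDiscr K : ℝ) ^ 2 * relDiscrNorm K := by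
    exact_mod_cast congrArg (Int.cast : ℤ → ℝ) hK.abs_discr_eq
  rw [Ideal.absNorm_top, hd] at h
  norm_num at h
  linarith

/-- The imaginary part of every period matrix has a bounded second minimum. -/
theorem secondMinimum_im_le (c : CMCoordinates A φ) (hK : IsPrimitiveQuarticCMField K)
    {b : Module.Basis (Fin 2 ⊕ Fin 2) ℤ A.lattice} {Z : Matrix (Fin 2) (Fin 2) ℂ}
    (hb : A.IsSymplecticBasis b) (hZ : A.IsPeriodMatrix b Z) {D : ℝ} (hD : 0 < D)
    (hD4 : D ^ 4 = (realSubfieldDiscr K : ℝ) ^ 2 * relDiscrNorm K) :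
    secondMinimum (Z.map Complex.im) ≤ D / 3 := by
  have hpd := hb.im_posDef hZ
  have hdet := hpd.det_pos
  have hmin : ∀ p : Fin 2 → ℤ, p ≠ 0 →
      (Z.map Complex.im).det * (4 / D) ≤ intQuadForm (Z.map Complex.im) p := by
    intro p hp
    rw [hb.intQuadForm_im hZ]
    refine mul_le_mul_of_nonneg_left ?_ hdet.le
    set x : A.lattice := p 1 • b (Sum.inr 0) - p 0 • b (Sum.inr 1) with hx
    have hx0 : (x : Fin 2 → ℂ) ≠ 0 := by
      intro h
      have hx' : x = 0 := Subtype.ext h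
      have h0 := congrArg (fun y => b.repr y (Sum.inr 0)) hx'
      have h1 := congrArg (fun y => b.repr y (Sum.inr 1)) hx'
      simp [hx] at h0 h1
      rcases fin_two_ne_zero hp with h | h
      · exact h h1
      · exact h h0
    have h16 := c.one_le_covolume_of_mem hK x.2 hx0
    set P := ‖c.coord (x : Fin 2 → ℂ) 0‖ * ‖c.coord (x : Fin 2 → ℂ) 1‖
    have hP : 0 ≤ P := by positivity
    have hDP : 2 ≤ D * P := by
      rw [← hD4, ← mul_pow] at h16
      exact le_of_pow_le_pow_left₀ (n := 4) (by norm_num) (by positivity) (by linarith)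
    have h2P := c.two_mul_norm_mul_norm_le (x : Fin 2 → ℂ)
    refine le_trans ?_ h2P
    rw [div_le_iff₀ hD]
    linarith
  -- The lower bound on the form carries the factor `det Y`, which cancels in `(4/3) det Y / m₁`.
  refine (secondMinimum_le_of_le ((hb.im_isSymm hZ).apply 0 1) hpd.diag_pos hdet
    (by positivity) hmin).trans (le_of_eq ?_)
  field_simp

theorem form_I_of_real {w : Fin 2 → ℂ} {r s : Fin 2 → ℝ} {x y : Fin 2 → ℂ}
    (hx : ∀ k, c.coord x k = r k * w k) (hy : ∀ k, c.coord y k = s k * w k) :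
    A.form (Complex.I • x) y = r 0 * s 0 * ‖w 0‖ ^ 2 + r 1 * s 1 * ‖w 1‖ ^ 2 := by
  have h : ∀ k, (c.coord (Complex.I • x) k * (starRingEnd ℂ) (c.coord y k)).im =
      r k * s k * ‖w k‖ ^ 2 := by
    intro k
    have : c.coord (Complex.I • x) k * (starRingEnd ℂ) (c.coord y k) =
        Complex.I * (r k * s k * ‖w k‖ ^ 2 : ℝ) := by
      rw [map_smul, Pi.smul_apply, hx, hy, map_mul, Complex.conj_ofReal, smul_eq_mul]
      push_cast
      rw [← Complex.mul_conj']
      ring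
    rw [this, Complex.I_mul_im, Complex.ofReal_re]
  rw [c.form_eq, Fin.sum_univ_two, h, h]

/-- A symplectic basis adapted to real multiplication through a short lattice vector. -/
theorem exists_reduced_symplecticBasis (c : CMCoordinates A φ)
    (hK : IsPrimitiveQuarticCMField K) :
    ∃ (b : Module.Basis (Fin 2 ⊕ Fin 2) ℤ A.lattice) (Z : Matrix (Fin 2) (Fin 2) ℂ) (M : ℝ),
      A.IsSymplecticBasis b ∧ A.IsPeriodMatrix b Z ∧ 0 < M ∧ M ^ 2 ≤ 6 / Real.pi ^ 2 ∧
      16 ≤ (realSubfieldDiscr K : ℝ) ^ 2 * relDiscrNorm K * M ^ 4 ∧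
      (Z.map Complex.im).det * (realSubfieldDiscr K * M ^ 2) = 1 ∧
      (Z.map Complex.im).det * (2 * M) ≤ firstMinimum (Z.map Complex.im) := by
  obtain ⟨v, hv, hv0, hvle⟩ := c.exists_norm_mul_norm_le
  obtain ⟨L, I, w, e, hI, hw, hsat, he, ⟨a₀, ha₀, ha₀0, hva₀⟩, hIw⟩ :=
    c.exists_realMultiplication_sublattice hK hv hv0
  obtain ⟨bI⟩ := NumberField.exists_basis_ideal hK.finrank_maximalRealSubfield hI
  have hrank : Module.finrank ℤ L = 2 := by
    rw [← e.finrank_eq, Module.finrank_eq_card_basis bI, Fintype.card_fin]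
  have hLe : ∀ x ∈ L, ∃ a : I, (e a : A.lattice) = x := fun x hx =>
    ⟨e.symm ⟨x, hx⟩, by rw [LinearEquiv.apply_symm_apply]⟩
  have hiso : ∀ x ∈ L, ∀ y ∈ L, A.form x y = 0 := by
    intro x hx y hy
    obtain ⟨a, rfl⟩ := hLe x hx
    obtain ⟨a', rfl⟩ := hLe y hy
    have h : ∀ k, (c.coord (e a : A.lattice) k *
        (starRingEnd ℂ) (c.coord (e a' : A.lattice) k)).im = 0 := by
      intro k
      have : c.coord (e a : A.lattice) k * (starRingEnd ℂ) (c.coord (e a' : A.lattice) k) =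
          ((c.embedding k (a : 𝓞 (maximalRealSubfield K))).re *
            (c.embedding k (a' : 𝓞 (maximalRealSubfield K))).re * ‖w k‖ ^ 2 : ℝ) := by
        rw [he, he, map_mul, Complex.conj_ofReal]
        push_cast
        rw [← Complex.mul_conj']
        ring
      rw [this, Complex.ofReal_im]
    rw [c.form_eq, Fin.sum_univ_two, h, h, add_zero]
  obtain ⟨b, vb, hb, hbv⟩ := A.exists_isSymplecticBasis hiso hsat hrank
  obtain ⟨Z, hZ⟩ := hb.exists_isPeriodMatrix
  let bI' : Module.Basis (Fin 2) ℤ I := vb.map e.symm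
  have hbe : ∀ i, b (Sum.inr i) = (e (bI' i) : A.lattice) := by
    intro i
    rw [hbv, Module.Basis.map_apply, LinearEquiv.apply_symm_apply]
  have hIpos : 0 < (Ideal.absNorm I : ℝ) := by
    exact_mod_cast Nat.pos_of_ne_zero (Ideal.absNorm_eq_zero_iff.not.mpr hI)
  have hM : I.map (algebraMap (𝓞 (maximalRealSubfield K)) (𝓞 K)) ≠ ⊥ := by
    rw [Ne, Ideal.map_eq_bot_iff_of_injective (FaithfulSMul.algebraMap_injective _ _)]
    exact hI
  have hw0 : ∀ k, w k ≠ 0 := c.coord_ne_zero hK hM hw hIw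
  have hWpos : 0 < ‖w 0‖ * ‖w 1‖ := mul_pos (norm_pos_iff.mpr (hw0 0)) (norm_pos_iff.mpr (hw0 1))
  have hnorm : Ideal.absNorm (I.map (algebraMap (𝓞 (maximalRealSubfield K)) (𝓞 K))) =
      Ideal.absNorm I ^ 2 := by
    have := hK.1
    rw [Ideal.absNorm_algebraMap, ← IsFractionRing.finrank_eq (𝓞 (maximalRealSubfield K))
      (maximalRealSubfield K) (𝓞 K) K,
      Algebra.IsQuadraticExtension.finrank_eq_two (maximalRealSubfield K) K]
  have hd : |(discr K : ℝ)| = (realSubfieldDiscr K : ℝ) ^ 2 * relDiscrNorm K := by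
    exact_mod_cast congrArg (Int.cast : ℤ → ℝ) hK.abs_discr_eq
  -- The Gram matrix is that of the trace form on `I` weighted by `|w_k|²`, so its determinant is
  -- `(|w₀||w₁|)²` times `N(I)²Δ₀`.
  have hgram : (A.riemannGram fun i => (b (Sum.inr i) : Fin 2 → ℂ)).det =
      realSubfieldDiscr K * (Ideal.absNorm I * (‖w 0‖ * ‖w 1‖)) ^ 2 := by
    have h := c.absNorm_sq_mul_realSubfieldDiscr hK bI'
    simp only [Matrix.det_fin_two, PrincipallyPolarizedAbelianVariety.riemannGram,
      Matrix.of_apply, hbe, c.form_I_of_real (he _) (he _)]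
    linear_combination (-(‖w 0‖ * ‖w 1‖) ^ 2) * h
  refine ⟨b, Z, Ideal.absNorm I * (‖w 0‖ * ‖w 1‖), hb, hZ, mul_pos hIpos hWpos, ?_, ?_, ?_, ?_⟩
  · refine le_trans ?_ hvle
    have h1 := c.absNorm_le_abs_mul hK ha₀ ha₀0
    rw [hva₀, hva₀, norm_mul, norm_mul, Complex.norm_real, Complex.norm_real, Real.norm_eq_abs,
      Real.norm_eq_abs]
    rw [abs_mul] at h1
    refine pow_le_pow_left₀ (by positivity) ?_ 2
    calc _ ≤ _ := mul_le_mul_of_nonneg_right h1 hWpos.le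
      _ = _ := by ring
  · have h := c.one_le_covolume hK hM hw hIw
    rw [hnorm, hd] at h
    push_cast at h
    linarith
  · rw [← hgram, hb.det_im_mul hZ]
  · refine le_firstMinimum fun p hp => ?_
    rw [hb.intQuadForm_im hZ]
    refine mul_le_mul_of_nonneg_left ?_ (hb.im_posDef hZ).det_pos.le
    set a : I := p 1 • bI' 0 - p 0 • bI' 1 with ha
    have hx : p 1 • b (Sum.inr 0) - p 0 • b (Sum.inr 1) = (e a : A.lattice) := by
      rw [hbe, hbe, ha, map_sub, map_zsmul, map_zsmul]
      rfl
    have ha0 : (a : 𝓞 (maximalRealSubfield K)) ≠ 0 := by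
      intro h
      have ha' : a = 0 := Subtype.ext h
      have h0 := congrArg (fun y => bI'.repr y 0) ha'
      have h1 := congrArg (fun y => bI'.repr y 1) ha'
      simp [ha] at h0 h1
      rcases fin_two_ne_zero hp with h | h
      · exact h h1
      · exact h h0
    have h1 := c.absNorm_le_abs_mul hK a.2 ha0
    have h2 := c.two_mul_norm_mul_norm_le (e a : A.lattice)
    rw [hx]
    refine le_trans ?_ h2
    rw [he, he, norm_mul, norm_mul, Complex.norm_real, Complex.norm_real, Real.norm_eq_abs,
      Real.norm_eq_abs]
    rw [abs_mul] at h1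
    have h3 := mul_le_mul_of_nonneg_right h1 hWpos.le
    linarith

end CMCoordinates

/-! ### The stated bounds -/

theorem mainTheorem5 (K : Type*) [Field K] [NumberField K] (hK : IsPrimitiveQuarticCMField K)
    (A : PrincipallyPolarizedAbelianVariety 2) (hA : A.HasCM K)
    (Δ₀ Δ₁ : ℝ) (hΔ₀ : Δ₀ = realSubfieldDiscr K) (hΔ₁ : Δ₁ = relDiscrNorm K) :
    (∃ (b : Module.Basis (Fin 2 ⊕ Fin 2) ℤ A.lattice) (Z' : Matrix (Fin 2) (Fin 2) ℂ)
        (Y' : Matrix (Fin 2) (Fin 2) ℝ),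
      A.IsSymplecticBasis b ∧ A.IsPeriodMatrix b Z' ∧ Z' ∈ siegelUpperHalfSpace 2 ∧
      Y' = Z'.map Complex.im ∧
      Real.pi ^ 2 / (6 * Δ₀) ≤ Y'.det ∧ Y'.det ≤ Δ₁ ^ (1 / 2 : ℝ) / 4 ∧
      2 * Real.pi / (Real.sqrt 6 * Δ₀ ^ (3 / 2 : ℝ)) ≤ firstMinimum Y' ∧
      firstMinimum Y' ≤ secondMinimum Y' ∧
      secondMinimum Y' ≤ Δ₁ ^ (1 / 4 : ℝ) * Δ₀ ^ (1 / 2 : ℝ) / 3 ∧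
      (16 ≤ Δ₁ → secondMinimum Y' ≤ Δ₁ ^ (1 / 2 : ℝ) * Δ₀ ^ (1 / 2 : ℝ) / 6)) ∧
    ∀ (b : Module.Basis (Fin 2 ⊕ Fin 2) ℤ A.lattice) (Z : Matrix (Fin 2) (Fin 2) ℂ),
      A.IsSymplecticBasis b → A.IsPeriodMatrix b Z →
      secondMinimum (Z.map Complex.im) ≤
        max (Real.sqrt 6 / (2 * Real.pi) * Δ₀ ^ (3 / 2 : ℝ))
          (2 / 9 * Δ₁ ^ (1 / 2 : ℝ) * Δ₀ ^ (1 / 2 : ℝ)) := by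
  obtain ⟨-, φ, hφ⟩ := hA
  obtain ⟨c⟩ := PrincipallyPolarizedAbelianVariety.nonempty_cmCoordinates hK hφ
  have h0 : 2 < Δ₀ := by
    rw [hΔ₀]
    exact_mod_cast hK.two_lt_realSubfieldDiscr c
  have h1 : 0 < Δ₁ := by
    rw [hΔ₁]
    exact_mod_cast hK.relDiscrNorm_pos
  have h0pos : 0 < Δ₀ := by linarith
  set s := Δ₀ ^ (1 / 2 : ℝ) with hs
  set q := Δ₁ ^ (1 / 4 : ℝ) with hq
  have hs0 : 0 < s := Real.rpow_pos_of_pos h0pos _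
  have hq0 : 0 < q := Real.rpow_pos_of_pos h1 _
  have hs2 : s ^ 2 = Δ₀ := by
    rw [hs, ← Real.rpow_natCast, ← Real.rpow_mul h0pos.le]
    norm_num
  have hs3 : Δ₀ ^ (3 / 2 : ℝ) = s ^ 3 := by
    rw [hs, ← Real.rpow_natCast, ← Real.rpow_mul h0pos.le]
    norm_num
  have hq2 : Δ₁ ^ (1 / 2 : ℝ) = q ^ 2 := by
    rw [hq, ← Real.rpow_natCast, ← Real.rpow_mul h1.le]
    norm_num
  have hq4 : q ^ 4 = Δ₁ := by
    rw [hq, ← Real.rpow_natCast, ← Real.rpow_mul h1.le]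
    norm_num
  rw [hs3, hq2]
  have hD4 : (q * s) ^ 4 = (realSubfieldDiscr K : ℝ) ^ 2 * relDiscrNorm K := by
    rw [← hΔ₀, ← hΔ₁, ← hs2, ← hq4]
    ring
  have hπ := Real.pi_pos
  have h6 : 0 < √(6 : ℝ) := Real.sqrt_pos.mpr (by norm_num)
  have h6sq : √(6 : ℝ) ^ 2 = 6 := Real.sq_sqrt (by norm_num)
  have h6le : 2 ≤ √(6 : ℝ) := Real.le_sqrt_of_sq_le (by norm_num)
  refine ⟨?_, fun b Z hb hZ => ?_⟩
  · obtain ⟨b, Z, M, hb, hZ, hM0, hM2, hM4, hdet, hm⟩ := c.exists_reduced_symplecticBasis hK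
    have hpd := hb.im_posDef hZ
    have hm2 := c.secondMinimum_im_le hK hb hZ (mul_pos hq0 hs0) hD4
    rw [← hΔ₀] at hM4 hdet
    rw [← hΔ₁] at hM4
    have hdpos := hpd.det_pos
    have hMle : M ≤ √6 / Real.pi := by
      refine le_of_pow_le_pow_left₀ (n := 2) two_ne_zero (by positivity) ?_
      rw [div_pow, h6sq]
      exact hM2
    have hYdet : (Z.map Complex.im).det = 1 / (Δ₀ * M ^ 2) :=
      eq_one_div_of_mul_eq_one_left hdet
    refine ⟨b, Z, _, hb, hZ, hb.mem_siegelUpperHalfSpace hZ, rfl, ?_, ?_, ?_,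
      firstMinimum_le_secondMinimum ((hb.im_isSymm hZ).apply 0 1) hpd.diag_pos hdpos, hm2,
      fun h16 => ?_⟩
    · rw [hYdet, div_le_div_iff₀ (by positivity) (by positivity)]
      rw [le_div_iff₀ (by positivity)] at hM2
      nlinarith
    · rw [hYdet, div_le_div_iff₀ (by positivity) (by norm_num)]
      have : 4 ≤ q ^ 2 * (Δ₀ * M ^ 2) := by
        refine le_of_pow_le_pow_left₀ (n := 2) two_ne_zero (by positivity) ?_
        calc (4 : ℝ) ^ 2 = 16 := by norm_num
          _ ≤ _ := hM4
          _ = _ := by rw [← hq4]; ring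
      linarith
    · refine le_trans ?_ hm
      rw [hYdet, ← hs2, div_le_iff₀ (by positivity)]
      have hMπ : M * Real.pi ≤ √6 := (le_div_iff₀ hπ).mp hMle
      -- The argument yields `m₁ ≥ 2π/(√6 Δ₀)`; the stated bound is weaker by the factor `s =
      -- Δ₀^{1/2} ≥ 1`.
      have hs1 : 1 ≤ s := by
        by_contra! h
        nlinarith
      have h2 : 1 / (s ^ 2 * M ^ 2) * (2 * M) * (√6 * s ^ 3) = 2 * (√6 * s) / M := by
        field_simp
      rw [h2, le_div_iff₀ hM0]
      nlinarith
    -- For `q = Δ₁^{1/4} ≥ 2` one has `qs/3 ≤ q²s/6`.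
    · have hq2' : 2 ≤ q := by
        refine le_of_pow_le_pow_left₀ (n := 4) (by norm_num) hq0.le ?_
        rw [hq4]
        linarith
      refine hm2.trans ?_
      have : q * 2 ≤ q * q := mul_le_mul_of_nonneg_left hq2' hq0.le
      nlinarith
  · refine (c.secondMinimum_im_le hK hb hZ (mul_pos hq0 hs0) hD4).trans ?_
    rw [le_max_iff]
    -- At `q = 3/2` the bound `qs/3` equals `(2/9)q²s`. Below that it is at most `s/2`, which the
    -- first term of the maximum dominates because `π ≤ 4 ≤ √6 Δ₀`.
    rcases le_total (3 / 2) q with h | h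
    · right
      have : q * (3 / 2) ≤ q * q := mul_le_mul_of_nonneg_left h hq0.le
      nlinarith
    · left
      have h4 := Real.pi_le_four
      have h2 : s / 2 ≤ √6 / (2 * Real.pi) * s ^ 3 := by
        rw [div_mul_eq_mul_div, div_le_div_iff₀ (by norm_num) (by positivity),
          show √6 * s ^ 3 * 2 = s * (2 * (√6 * s ^ 2)) by ring, hs2]
        refine mul_le_mul_of_nonneg_left ?_ hs0.le
        nlinarith
      refine le_trans ?_ h2
      have := mul_le_mul_of_nonneg_right h hs0.le
      linarith
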